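/- Graphs are finite and may have parallel edges and loops; a loop contributes $2$ to the degree of its vertex. A graph $F$ appears in a graph $G$ as a strong immersion if there is a map $\theta$ that sends the vertices of $F$ injectively to vertices of $G$ and the edges of $F$ to connected, pairwise edge-disjoint subgraphs of $G$ such that, for every edge $e$ and every vertex $v$ of $F$: $\theta(v)$ belongs to $\theta(e)$ if and only if $e$ is incident with $v$, and if $e$ is a loop at $v$, then $\theta(e)$ contains a cycle (a loop or a pair of parallel edges counts as a cycle) passing through $\theta(v)$. Let $d(k)=(2k+1)^{8k+4}k^2(k+1)$. Theorem 5. Let $k\ge 3$ be an integer, let $G$ be a graph and let $c$ be a vertex of $G$. Let $X\subseteq V(G)\setminus\{c\}$ be a set of vertices such that, for every $x\in X$, no set of fewer than $k$ edges of $G$ separates $c$ from $x$ (that is, $c$ and $x$ lie in the same component of $G-K$ for every $K\subseteq E(G)$ with $|K|<k$). Let $F$ be a graph of maximum degree at most $k$ that does not appear in $G$ as a strong immersion. Then there exist sets $Y\subseteq X$ and $K\subseteq E(G)$ such that $$k|Y|+|K|<d(k)\,|V(F)|$$ and the component of $G-Y-K$ that contains $c$ does not contain any vertex of $X$. -/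

import Mathlib

open scoped Graph

/-! Multigraphs (parallel edges and loops allowed) are Mathlib's `Graph α β`. -/

namespace Graph

variable {α β γ δ : Type*}

/-- `v` is reachable from `u` in `G`: `u` is a vertex of `G`, and there is a walk from `u` to `v`. -/
def Reachable (G : Graph α β) (u v : α) : Prop :=
  u ∈ V(G) ∧ Relation.ReflTransGen G.Adj u v

/-- The vertex set of the component of `G` that contains `u` (empty if `u` is not a vertex). -/
def componentSet (G : Graph α β) (u : α) : Set α :=
  {v | G.Reachable u v}

/-- A graph is connected if it has a vertex and any two of its vertices are joined by a walk. -/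
def IsConnected (G : Graph α β) : Prop :=
  V(G).Nonempty ∧ ∀ u ∈ V(G), ∀ v ∈ V(G), G.Reachable u v

/-- The degree of a vertex (in a graph with finitely many edges); each loop contributes `2`. -/
noncomputable def degree (G : Graph α β) (v : α) : ℕ :=
  (G.incidenceSet v).ncard + (G.loopSet v).ncard

/-- `C` is a cycle: a finite connected graph all of whose vertices have degree `2`.
A vertex with a loop is a cycle of length one, two parallel edges form a cycle of length two. -/
structure IsCycle (C : Graph α β) : Prop where
  finite_vertexSet : V(C).Finite
  finite_edgeSet : E(C).Finite
  connected : C.IsConnected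
  degree_eq_two : ∀ v ∈ V(C), C.degree v = 2

/-- `K` is a set of edges of `G` that separates `u` from `v`: `u` and `v` are not in the same
component of `G - K`. -/
def IsEdgeCutBetween (G : Graph α β) (K : Set β) (u v : α) : Prop :=
  K ⊆ E(G) ∧ ¬ (G.deleteEdges K).Reachable u v

/-- An immersion of `H` in `G`. -/
structure Immersion (H : Graph γ δ) (G : Graph α β) where
  /-- The branch vertex of each vertex of `H`. -/
  onVertex : V(H) → V(G)
  /-- The subgraph of `G` assigned to each edge of `H`. -/
  onEdge : E(H) → Graph α β
  injective_onVertex : Function.Injective onVertex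
  onEdge_le : ∀ e, onEdge e ≤ G
  connected_onEdge : ∀ e, (onEdge e).IsConnected
  edgeDisjoint : ∀ e f, e ≠ f → Disjoint E(onEdge e) E(onEdge f)
  mem_of_inc : ∀ (e : E(H)) (v : V(H)), H.Inc e v → (onVertex v : α) ∈ V(onEdge e)
  cycle_of_loop : ∀ (e : E(H)) (v : V(H)), H.IsLoopAt e v →
    ∃ C : Graph α β, C ≤ onEdge e ∧ C.IsCycle ∧ (onVertex v : α) ∈ V(C)

/-- An immersion is strong if the subgraph assigned to an edge `e` contains no branch vertex of a
vertex that is not incident with `e`. -/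
def Immersion.IsStrong {H : Graph γ δ} {G : Graph α β} (θ : Immersion H G) : Prop :=
  ∀ (e : E(H)) (v : V(H)), ¬ H.Inc e v → (θ.onVertex v : α) ∉ V(θ.onEdge e)

/-- `H` appears in `G` as a strong immersion. -/
def StronglyImmersed (H : Graph γ δ) (G : Graph α β) : Prop :=
  ∃ θ : Immersion H G, θ.IsStrong

/-- The function `d(k) = (2k+1)^(8k+4) k^2 (k+1)`. -/
def starBound (k : ℕ) : ℕ :=
  (2 * k + 1) ^ (8 * k + 4) * k ^ 2 * (k + 1)

end Graph

/-!
A *spider* consists of a vertex `c`, a set `S` of branch vertices, and edge-disjoint paths to `c`,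
`k` of them from each branch vertex, with no branch vertex inside of a path. Every graph `F` of
maximum degree at most `k` with at most `|S|` vertices is strongly immersed in a spider: an edge is
routed through `c` along two of the paths (`Graph.stronglyImmersed_of_spider`). So it suffices to
find a spider with `|V(F)|` branch vertices in `X`, unless deleting few vertices of `X` and few
edges separates `c` from `X`. By a version of Menger's theorem, deduced from Hall's theorem, each of
the path systems below is obtained from a cut condition (`Graph.CutCondition.exists_linkage`).

* If no cheap separator exists, then there is a large set `X₁ ⊆ X` whose vertices are joined to `c`
  by one path each, with no inner vertex in `X` (`Graph.exists_sources_and_separator`).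
* A fraction `k⁻ᵏ` of the vertices of `X₁` can be joined to `c` by `k` paths each, if the paths may
  pass through other vertices of `X` (`Graph.exists_fan_sources`). Indeed, for a maximal such set
  `X'`, every other vertex of `X₁` lies in a set that is nearly tight. As edge boundaries are
  submodular, and disjoint sets attached to a given one use up different edges of its boundary,
  all of `X₁ \ X'` can be enclosed in a set `A` for which the number of boundary edges plus
  `k|X' \ A|` is at most `kᵏ|X'|` (`Graph.exists_cover`). The single paths show that this value is
  at least `|X₁|`.
* The vertices of `X'` now have both the `k` paths and the single path. For `T ⊆ X'`, a stable
  matching of the former paths from `T` with the single paths of all of `X'` tells which of the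
  former switch to which of the latter. As each vertex of `X'` that is met accounts for a single
  path that is taken, the rerouted paths meet at most `k|T|` vertices of `X'`. The set `V T` of
  these grows with `T` (`Graph.exists_reroute`). A double counting gives a set `S ⊆ X'`, of at
  least a fraction `1 / (4k + 2)` of the vertices, such that `z ∉ V (S \ {z})` for all `z ∈ S`
  (`Graph.exists_independent`). This `S` satisfies the cut condition for a spider: a cut has
  to be checked only for the set `T ⊆ S` of branch vertices on one side, by means of the paths
  rerouted for `T`, and these avoid `S \ T` as `V` is monotone (`Graph.exists_spider_sources`).
-/

namespace Graph

variable {α β γ δ : Type*}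

/-! ### Edge boundaries -/

/-- The edges of `G` that join a vertex of `B` to a vertex outside `B ∪ Z`. For `Z = ∅` this is the
usual edge boundary of `B`; in general it is the boundary of `B` in the graph in which the vertices
of `Z` outside `B` have been deleted. -/
def edgeBoundary (G : Graph α β) (B Z : Set α) : Set β :=
  {e | ∃ u v, G.IsLink e u v ∧ u ∈ B ∧ v ∉ B ∧ v ∉ Z}

lemma edgeBoundary_subset (G : Graph α β) (B Z : Set α) : G.edgeBoundary B Z ⊆ E(G) := by
  rintro e ⟨u, v, h, -⟩
  exact h.edge_mem

lemma finite_edgeBoundary {G : Graph α β} (hGE : E(G).Finite) (B Z : Set α) :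
    (G.edgeBoundary B Z).Finite :=
  hGE.subset (G.edgeBoundary_subset B Z)

lemma edgeBoundary_empty (G : Graph α β) (Z : Set α) : G.edgeBoundary ∅ Z = ∅ := by
  simp [edgeBoundary]

lemma ncard_edgeBoundary_submodular {G : Graph α β} (hGE : E(G).Finite) (A B Z : Set α) :
    (G.edgeBoundary (A ∪ B) Z).ncard + (G.edgeBoundary (A ∩ B) Z).ncard ≤
      (G.edgeBoundary A Z).ncard + (G.edgeBoundary B Z).ncard := by
  rw [← Set.ncard_union_add_ncard_inter _ _ (finite_edgeBoundary hGE _ _)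
      (finite_edgeBoundary hGE _ _),
    ← Set.ncard_union_add_ncard_inter (G.edgeBoundary A Z) _ (finite_edgeBoundary hGE _ _)
      (finite_edgeBoundary hGE _ _)]
  refine Nat.add_le_add (Set.ncard_le_ncard ?_ ?_) (Set.ncard_le_ncard ?_ ?_)
  · rintro e (⟨u, v, h, hu, hv, hz⟩ | ⟨u, v, h, hu, hv, hz⟩)
    · rcases hu with hu | hu
      · exact .inl ⟨u, v, h, hu, fun h' ↦ hv (.inl h'), hz⟩
      · exact .inr ⟨u, v, h, hu, fun h' ↦ hv (.inr h'), hz⟩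
    · by_cases hA : v ∈ A
      · exact .inr ⟨u, v, h, hu.2, fun h' ↦ hv ⟨hA, h'⟩, hz⟩
      · exact .inl ⟨u, v, h, hu.1, hA, hz⟩
  · exact (finite_edgeBoundary hGE _ _).union (finite_edgeBoundary hGE _ _)
  · rintro e ⟨⟨u, v, h, hu, hv, hz⟩, ⟨u', v', h', hu', hv', hz'⟩⟩
    rcases h'.eq_and_eq_or_eq_and_eq h with ⟨rfl, rfl⟩ | ⟨rfl, rfl⟩
    · exact ⟨⟨_, _, h, hu'.1, fun h' ↦ hv (.inl h'), hz⟩,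
        ⟨_, _, h, hu'.2, fun h' ↦ hv (.inr h'), hz⟩⟩
    · exact absurd (.inl hu'.1) hv
  · exact (finite_edgeBoundary hGE _ _).inter_of_left _

/-- The cut condition for `k` edge-disjoint paths from each vertex of `S` to `c` that enter no
vertex of `Z`: every set `B` of vertices that avoids `c` has an edge boundary, with `Z` deleted, of
at least `k * |S ∩ B|` edges. It is sufficient by `Graph.CutCondition.exists_linkage`. -/
def CutCondition (G : Graph α β) (c : α) (S : Finset α) (k : ℕ) (Z : Set α) : Prop :=
  ∀ B ⊆ V(G) \ {c}, k * (↑S ∩ B).ncard ≤ (G.edgeBoundary B Z).ncard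

lemma CutCondition.mono {G : Graph α β} {c : α} {S T : Finset α} {k : ℕ} {Z : Set α}
    (h : G.CutCondition c S k Z) (hTS : T ⊆ S) : G.CutCondition c T k Z := fun B hB ↦
  (Nat.mul_le_mul_left k (Set.ncard_le_ncard
    (Set.inter_subset_inter_left B (Finset.coe_subset.2 hTS))
    (S.finite_toSet.inter_of_left B))).trans (h B hB)

/-! ### Simple paths -/

/-- A path from `x` to `y` in `G` without repeated vertices, given by its sequence of vertices and
its sequence of edges. The values of `vert` beyond `length`, and those of `edge` from `length`
on, carry no meaning. -/
structure SimplePath (G : Graph α β) (x y : α) where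
  /-- The number of edges. -/
  length : ℕ
  /-- The sequence of vertices. -/
  vert : ℕ → α
  /-- The sequence of edges: edge `j` joins the vertices `j` and `j + 1`. -/
  edge : ℕ → β
  vert_zero : vert 0 = x
  vert_length : vert length = y
  isLink : ∀ j < length, G.IsLink (edge j) (vert j) (vert (j + 1))
  vert_inj : ∀ i ≤ length, ∀ j ≤ length, vert i = vert j → i = j

namespace SimplePath

variable {G : Graph α β} {x y : α}

/-- The set of vertices of a path. -/
def verts (p : G.SimplePath x y) : Set α := {v | ∃ j ≤ p.length, p.vert j = v}

/-- The set of edges of a path. -/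
def edges (p : G.SimplePath x y) : Set β := {e | ∃ j < p.length, p.edge j = e}

lemma edge_inj (p : G.SimplePath x y) {i j : ℕ} (hi : i < p.length) (hj : j < p.length)
    (h : p.edge i = p.edge j) : i = j := by
  have h1 := p.isLink i hi
  rw [h] at h1
  rcases h1.eq_and_eq_or_eq_and_eq (p.isLink j hj) with ⟨h2, -⟩ | ⟨h2, h3⟩
  · exact p.vert_inj i hi.le j hj.le h2
  · have a := p.vert_inj i hi.le (j + 1) hj h2
    have b := p.vert_inj (i + 1) hi j hj.le h3
    omega

/-- A sequence of vertices that starts in `B` and ends outside `B` leaves `B` at some step. -/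
lemma exists_leaving {v : ℕ → α} {B : Set α} {a b : ℕ} (hab : a ≤ b) (ha : v a ∈ B)
    (hb : v b ∉ B) : ∃ j, a ≤ j ∧ j < b ∧ v j ∈ B ∧ v (j + 1) ∉ B := by
  induction b, hab using Nat.le_induction with
  | base => exact absurd ha hb
  | succ b hab ih =>
    by_cases h : v b ∈ B
    · exact ⟨b, hab, b.lt_succ_self, h, hb⟩
    · obtain ⟨j, h1, h2, h3, h4⟩ := ih h
      exact ⟨j, h1, by omega, h3, h4⟩

/-- A walk, given as a chain of steps along edges of `D` into vertices outside `Z`, contains a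
simple path. -/
lemma exists_of_reflTransGen [Nonempty β] {D : Set β} {Z : Set α} (h : Relation.ReflTransGen
      (fun u v ↦ ∃ e ∈ D, G.IsLink e u v ∧ v ∉ Z) x y) :
    ∃ p : G.SimplePath x y, p.edges ⊆ D ∧ ∀ j, 0 < j → j ≤ p.length → p.vert j ∉ Z := by
  classical
  induction h using Relation.ReflTransGen.head_induction_on with
  | refl =>
    refine ⟨⟨0, fun _ ↦ y, fun _ ↦ Classical.arbitrary β, rfl, rfl, by simp, ?_⟩, ?_, ?_⟩
    · intro i hi j hj _
      omega
    · rintro _ ⟨j, hj, -⟩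
      exact absurd hj (by simp)
    · intro j h0 hj
      exact absurd (show j ≤ 0 from hj) (by omega)
  | @head a u hau _ ih =>
    obtain ⟨e, he, hl, hu⟩ := hau
    obtain ⟨p, hp, hpZ⟩ := ih
    by_cases ha : ∃ i ≤ p.length, p.vert i = a
    · -- the walk returns to `a`: keep only the part of the path after the return
      obtain ⟨i, hi, hia⟩ := ha
      refine ⟨⟨p.length - i, fun j ↦ p.vert (j + i), fun j ↦ p.edge (j + i), by simpa using hia,
        ?_, ?_, ?_⟩, ?_, ?_⟩
      · simp only [Nat.sub_add_cancel hi, p.vert_length]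
      · intro j hj
        have := p.isLink (j + i) (by omega)
        rwa [show j + i + 1 = j + 1 + i by omega] at this
      · intro j hj l hl' h
        have := p.vert_inj (j + i) (by omega) (l + i) (by omega) h
        omega
      · rintro _ ⟨j, hj, rfl⟩
        exact hp ⟨j + i, by simp only at hj; omega, rfl⟩
      · intro j h0 hj
        exact hpZ (j + i) (by omega) (by simp only at hj; omega)
    · push Not at ha
      refine ⟨⟨p.length + 1, fun j ↦ if j = 0 then a else p.vert (j - 1),
        fun j ↦ if j = 0 then e else p.edge (j - 1), by simp, by simp [p.vert_length], ?_, ?_⟩,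
        ?_, ?_⟩
      · intro j hj
        rcases j with _ | j
        · simpa [p.vert_zero] using hl
        · simpa using p.isLink j (by omega)
      · intro i hi j hj h
        rcases i with _ | i <;> rcases j with _ | j
        · rfl
        · simp only [if_true, Nat.add_one_ne_zero, if_false, Nat.add_sub_cancel] at h
          exact absurd h.symm (ha j (by omega))
        · simp only [if_true, Nat.add_one_ne_zero, if_false, Nat.add_sub_cancel] at h
          exact absurd h (ha i (by omega))
        · simp only [Nat.add_one_ne_zero, if_false, Nat.add_sub_cancel] at h
          have := p.vert_inj i (by omega) j (by omega) h
          omega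
      · rintro _ ⟨j, hj, rfl⟩
        rcases j with _ | j
        · simpa using he
        · simpa using hp ⟨j, by simp only at hj; omega, rfl⟩
      · intro j h0 hj
        rcases j with _ | _ | j
        · omega
        · simpa [p.vert_zero] using hu
        · simpa using hpZ (j + 1) (by omega) (by simp only at hj; omega)

end SimplePath

/-! ### Edge-disjoint paths from many sources to one sink -/

/-- The matching that encodes a linkage. Every slot `(s, i)` is matched to an edge at `s`, and every
edge that avoids `c` is matched to itself or to an edge with which it shares an end outside `Z`,
so that no edge is used twice. Hall's condition follows from the cut condition, applied to
the set of vertices from which a set of slots and edges may continue. -/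
lemma exists_linkage_matching {G : Graph α β} (hGE : E(G).Finite) {c : α} {S : Finset α}
    (hSV : ↑S ⊆ V(G) \ {c}) {Z : Set α} {k : ℕ}
    (h : G.CutCondition c S k Z) :
    ∃ σ : (S × Fin k) ⊕ {e // e ∈ E(G) ∧ ¬ G.Inc e c} → β, Function.Injective σ ∧
      (∀ i, G.Inc (σ (.inl i)) i.1) ∧
      ∀ e, σ (.inr e) = e.1 ∨ ∃ v, v ∉ Z ∧ G.Inc e.1 v ∧ G.Inc (σ (.inr e)) v := by
  classical
  let t : (S × Fin k) ⊕ {e // e ∈ E(G) ∧ ¬ G.Inc e c} → Set β := fun a ↦ match a with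
    | .inl i => {f | G.Inc f i.1}
    | .inr e => {f | f = e.1 ∨ ∃ v, v ∉ Z ∧ G.Inc e.1 v ∧ G.Inc f v}
  have ht : ∀ a, t a ⊆ E(G) := by
    rintro (i | e) f hf
    · exact Inc.edge_mem hf
    · rcases hf with rfl | ⟨v, -, -, hf⟩
      · exact e.2.1
      · exact hf.edge_mem
  have htf : ∀ a, (t a).Finite := fun a ↦ hGE.subset (ht a)
  obtain ⟨σ, hσ, hσt⟩ := (Finset.all_card_le_biUnion_card_iff_exists_injective
    (fun a ↦ (htf a).toFinset)).1 (by
      intro U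
      set U₁ := U.toLeft with hU₁
      set U₂ := U.toRight with hU₂
      let B : Set α := {v | (∃ i ∈ U₁, (i.1 : α) = v) ∨ (v ∉ Z ∧ ∃ e ∈ U₂, G.Inc e.1 v)}
      have hB : B ⊆ V(G) \ {c} := by
        rintro v (⟨i, -, rfl⟩ | ⟨-, e, -, he⟩)
        · exact hSV i.1.2
        · exact ⟨he.vertex_mem, by rintro rfl; exact e.2.2 he⟩
      have hBf : (↑S ∩ B).Finite := S.finite_toSet.inter_of_left _
      have hU₁card : U₁.card ≤ k * (↑S ∩ B).ncard := by
        have : U₁ ⊆ (S.attach.filter fun s ↦ s.1 ∈ B) ×ˢ (Finset.univ : Finset (Fin k)) := by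
          intro i hi
          simp only [Finset.mem_product, Finset.mem_filter, Finset.mem_attach, true_and,
            Finset.mem_univ, and_true]
          exact .inl ⟨i, hi, rfl⟩
        refine (Finset.card_le_card this).trans ?_
        rw [Finset.card_product, Finset.card_univ, Fintype.card_fin, mul_comm]
        refine Nat.mul_le_mul_left k ?_
        rw [← Finset.card_map (Function.Embedding.subtype _), ← Set.ncard_coe_finset]
        refine Set.ncard_le_ncard ?_ hBf
        intro v hv
        simp only [Finset.coe_map, Function.Embedding.subtype_apply, Set.mem_image,
          Finset.mem_coe, Finset.mem_filter] at hv
        obtain ⟨s, ⟨-, hs⟩, rfl⟩ := hv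
        exact ⟨s.2, hs⟩
      have hdisj : Disjoint (U₂.image Subtype.val) (finite_edgeBoundary hGE B Z).toFinset := by
        rw [Finset.disjoint_left]
        intro f hf hf'
        obtain ⟨e, he, rfl⟩ := Finset.mem_image.1 hf
        obtain ⟨u, v, hl, -, hvB, hvZ⟩ := (Set.Finite.mem_toFinset _).1 hf'
        exact hvB (.inr ⟨hvZ, e, he, hl.inc_right⟩)
      have hsub : (U₂.image Subtype.val) ∪ (finite_edgeBoundary hGE B Z).toFinset ⊆
          U.biUnion fun a ↦ (htf a).toFinset := by
        intro f hf
        rw [Finset.mem_biUnion]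
        rcases Finset.mem_union.1 hf with hf | hf
        · obtain ⟨e, he, rfl⟩ := Finset.mem_image.1 hf
          exact ⟨.inr e, Finset.mem_toRight.1 he, (Set.Finite.mem_toFinset _).2 (.inl rfl)⟩
        · obtain ⟨u, v, hl, huB, -, -⟩ := (Set.Finite.mem_toFinset _).1 hf
          rcases huB with ⟨i, hi, rfl⟩ | ⟨huZ, e, he, hu⟩
          · exact ⟨.inl i, Finset.mem_toLeft.1 hi, (Set.Finite.mem_toFinset _).2 hl.inc_left⟩
          · exact ⟨.inr e, Finset.mem_toRight.1 he,
              (Set.Finite.mem_toFinset _).2 (.inr ⟨u, huZ, hu, hl.inc_left⟩)⟩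
      calc U.card = U₁.card + U₂.card := (Finset.card_toLeft_add_card_toRight).symm
        _ ≤ (G.edgeBoundary B Z).ncard + U₂.card :=
          Nat.add_le_add_right (hU₁card.trans (h B hB)) _
        _ = (U₂.image Subtype.val ∪ (finite_edgeBoundary hGE B Z).toFinset).card := by
          rw [Finset.card_union_of_disjoint hdisj,
            Finset.card_image_of_injective _ Subtype.val_injective,
            Set.ncard_eq_toFinset_card _ (finite_edgeBoundary hGE B Z), add_comm]
        _ ≤ _ := Finset.card_le_card hsub)
  refine ⟨σ, hσ, fun i ↦ ?_, fun e ↦ ?_⟩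
  · have := (Set.Finite.mem_toFinset _).1 (hσt (.inl i))
    exact this
  · have := (Set.Finite.mem_toFinset _).1 (hσt (.inr e))
    exact this

/-- An edge version of Menger's theorem: the cut condition provides edge-disjoint simple paths to
`c`, `k` of them from each vertex of `S`, that have no vertex in `Z` except possibly the first. -/
theorem CutCondition.exists_linkage {G : Graph α β} (hGE : E(G).Finite) {c : α} {S : Finset α}
    (hSV : ↑S ⊆ V(G) \ {c}) {Z : Set α} (hcZ : c ∉ Z) {k : ℕ}
    (h : G.CutCondition c S k Z) :
    ∃ p : ∀ i : S × Fin k, G.SimplePath (i.1 : α) c,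
      (∀ i j, i ≠ j → Disjoint (p i).edges (p j).edges) ∧
      ∀ i, ∀ j, 0 < j → j ≤ (p i).length → (p i).vert j ∉ Z := by
  classical
  obtain ⟨σ, hσ, hσ₁, hσ₂⟩ := exists_linkage_matching hGE hSV h
  -- follow the matching from each slot until an edge at `c` is reached
  let g : β → β := fun e ↦ if he : e ∈ E(G) ∧ ¬ G.Inc e c then σ (.inr ⟨e, he⟩) else e
  let o : S × Fin k → ℕ → β := fun i n ↦ g^[n] (σ (.inl i))
  have ho0 : ∀ i, o i 0 = σ (.inl i) := fun i ↦ rfl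
  have hoS : ∀ i n, o i (n + 1) = g (o i n) := fun i n ↦ Function.iterate_succ_apply' _ _ _
  have hσE : ∀ a, σ a ∈ E(G) := by
    rintro (i | e)
    · exact (hσ₁ i).edge_mem
    · rcases hσ₂ e with h | ⟨v, -, -, h⟩
      · rw [h]; exact e.2.1
      · exact h.edge_mem
  have hoE : ∀ i n, o i n ∈ E(G) := by
    intro i n
    induction n with
    | zero => exact hσE _
    | succ n ih =>
      rw [hoS]
      by_cases he : o i n ∈ E(G) ∧ ¬ G.Inc (o i n) c
      · simp only [g, dif_pos he]; exact hσE _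
      · simp only [g, dif_neg he]; exact ih
  have hoσ : ∀ i n (hn : ¬ G.Inc (o i n) c), o i (n + 1) = σ (.inr ⟨o i n, hoE i n, hn⟩) := by
    intro i n hn
    rw [hoS]
    simp only [g, dif_pos (show o i n ∈ E(G) ∧ ¬ G.Inc (o i n) c from ⟨hoE i n, hn⟩)]
  have huniq : ∀ a b i j, (∀ n < a, ¬ G.Inc (o i n) c) → (∀ n < b, ¬ G.Inc (o j n) c) →
      o i a = o j b → i = j ∧ a = b := by
    intro a
    induction a with
    | zero =>
      intro b i j _ hb hab
      rcases b with _ | b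
      · exact ⟨by simpa using hσ hab, rfl⟩
      · rw [ho0, hoσ j b (hb b b.lt_succ_self)] at hab
        simpa using hσ hab
    | succ a ih =>
      intro b i j ha hb hab
      rcases b with _ | b
      · rw [ho0, hoσ i a (ha a a.lt_succ_self)] at hab
        simpa using hσ hab
      · rw [hoσ i a (ha a a.lt_succ_self), hoσ j b (hb b b.lt_succ_self)] at hab
        have := hσ hab
        simp only [Sum.inr.injEq, Subtype.mk.injEq] at this
        have := ih b i j (fun n hn ↦ ha n (by omega)) (fun n hn ↦ hb n (by omega)) this
        exact ⟨this.1, by omega⟩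
  have hterm : ∀ i, ∃ n, G.Inc (o i n) c := by
    intro i
    by_contra! hne
    have hinj : Function.Injective (o i) := fun a b hab ↦
      (huniq a b i i (fun n _ ↦ hne n) (fun n _ ↦ hne n) hab).2
    exact Set.infinite_of_injective_forall_mem hinj (hoE i) hGE
  let N : S × Fin k → ℕ := fun i ↦ Nat.find (hterm i)
  have hN : ∀ i, G.Inc (o i (N i)) c := fun i ↦ Nat.find_spec (hterm i)
  have hNlt : ∀ i, ∀ n < N i, ¬ G.Inc (o i n) c := fun i n hn ↦ Nat.find_min (hterm i) hn
  let D : S × Fin k → Set β := fun i ↦ {e | ∃ n ≤ N i, o i n = e}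
  let step : S × Fin k → α → α → Prop := fun i u v ↦ ∃ e ∈ D i, G.IsLink e u v ∧ v ∉ Z
  have hmove : ∀ i n u v, n ≤ N i → G.Inc (o i n) u → G.Inc (o i n) v → v ∉ Z →
      Relation.ReflTransGen (step i) (i.1 : α) u → Relation.ReflTransGen (step i) (i.1 : α) v := by
    intro i n u v hn hu hv hvZ hr
    obtain ⟨w, hw⟩ := hu
    rcases hv.eq_or_eq_of_isLink hw with rfl | rfl
    · exact hr
    · exact hr.tail ⟨_, ⟨n, hn, rfl⟩, hw, hvZ⟩
  have hreach : ∀ i n, n ≤ N i → ∃ u, G.Inc (o i n) u ∧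
      Relation.ReflTransGen (step i) (i.1 : α) u := by
    intro i n
    induction n with
    | zero => exact fun _ ↦ ⟨_, hσ₁ i, .refl⟩
    | succ n ih =>
      intro hn
      obtain ⟨u, hu, hr⟩ := ih (by omega)
      have hnc := hNlt i n (by omega)
      rcases hσ₂ ⟨o i n, hoE i n, hnc⟩ with h1 | ⟨v, hvZ, h1, h2⟩
      · exact ⟨u, by rw [hoσ i n hnc, h1]; exact hu, hr⟩
      · exact ⟨v, by rw [hoσ i n hnc]; exact h2, hmove i n u v (by omega) hu h1 hvZ hr⟩
  have hpath : ∀ i : S × Fin k, ∃ p : G.SimplePath (i.1 : α) c, p.edges ⊆ D i ∧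
      ∀ j, 0 < j → j ≤ p.length → p.vert j ∉ Z := by
    intro i
    have : Nonempty β := ⟨o i 0⟩
    obtain ⟨u, hu, hr⟩ := hreach i (N i) le_rfl
    exact SimplePath.exists_of_reflTransGen (hmove i (N i) u c le_rfl hu (hN i) hcZ hr)
  choose p hp hpZ using hpath
  refine ⟨p, fun i j hij ↦ ?_, hpZ⟩
  rw [Set.disjoint_left]
  intro e hi hj
  obtain ⟨a, ha, hae⟩ := hp i hi
  obtain ⟨b, hb, hbe⟩ := hp j hj
  exact hij (huniq a b i j (fun n hn ↦ hNlt i n (by omega)) (fun n hn ↦ hNlt j n (by omega))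
    (hae.trans hbe.symm)).1

/-! ### Sources of paths that avoid `X` -/

/-- The mixed version of Menger's theorem in which both vertices of `X` and edges may be deleted:
a largest set `X₁ ⊆ X` that satisfies the cut condition for single paths with no inner vertex in `X`
is at least as large as some set of vertices of `X` and edges that separates `c` from `X`. -/
theorem exists_sources_and_separator {G : Graph α β} (hGV : V(G).Finite) (hGE : E(G).Finite) {c : α}
    {X : Set α} (hX : X ⊆ V(G) \ {c}) :
    ∃ X₁ : Finset α, ↑X₁ ⊆ X ∧ G.CutCondition c X₁ 1 X ∧
      ∃ (Y : Set α) (K : Set β), Y ⊆ X ∧ K ⊆ E(G) ∧ Y.ncard + K.ncard ≤ X₁.card ∧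
        Disjoint (((G.deleteVerts Y).deleteEdges K).componentSet c) X := by
  classical
  have hXf : X.Finite := hGV.subset fun x hx ↦ (hX hx).1
  have hΩ : (V(G) \ {c}).Finite := hGV.sdiff
  obtain ⟨X₁, hX₁, hmax⟩ := Finset.exists_max_image
    (hXf.toFinset.powerset.filter fun S ↦ G.CutCondition c S 1 X) Finset.card
    ⟨∅, by simp [CutCondition]⟩
  simp only [Finset.mem_filter, Finset.mem_powerset, Set.Finite.subset_toFinset] at hX₁ hmax
  obtain ⟨hX₁X, hcut⟩ := hX₁
  -- a largest tight set contains all the others, and so it contains `X \ X₁`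
  obtain ⟨B, hB, hBmax⟩ := Set.exists_max_image
    {B | B ⊆ V(G) \ {c} ∧ (G.edgeBoundary B X).ncard ≤ (↑X₁ ∩ B).ncard} Set.ncard
    (hΩ.powerset.subset fun B hB ↦ hB.1) ⟨∅, by simp [edgeBoundary_empty]⟩
  have hfin : ∀ A : Set α, (↑X₁ ∩ A).Finite := fun A ↦ X₁.finite_toSet.inter_of_left A
  have hunion : ∀ A, A ⊆ V(G) \ {c} → (G.edgeBoundary A X).ncard ≤ (↑X₁ ∩ A).ncard → A ⊆ B := by
    intro A hA hAt
    have h1 := ncard_edgeBoundary_submodular hGE A B X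
    have h2 := hcut (A ∩ B) (Set.inter_subset_left.trans hA)
    have h3 := Set.ncard_union_add_ncard_inter (↑X₁ ∩ A) (↑X₁ ∩ B) (hfin A) (hfin B)
    rw [← Set.inter_union_distrib_left, ← Set.inter_inter_distrib_left] at h3
    have h4 := hB.2
    have h5 := hBmax (A ∪ B) ⟨Set.union_subset hA hB.1, by omega⟩
    have h6 := Set.eq_of_subset_of_ncard_le (Set.subset_union_right (s := A) (t := B)) h5
      (hΩ.subset (Set.union_subset hA hB.1))
    rw [h6]
    exact Set.subset_union_left
  have hXB : X \ ↑X₁ ⊆ B := by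
    rintro x ⟨hx, hx₁⟩
    have hx₁ : x ∉ X₁ := hx₁
    by_contra hxB
    have hins : G.CutCondition c (insert x X₁) 1 X := by
      intro A hA
      by_cases hxA : x ∈ A
      · by_contra! hlt
        refine hxB (hunion A hA ?_ hxA)
        have : ↑(insert x X₁) ∩ A ⊆ insert x (↑X₁ ∩ A) := by
          rintro y ⟨hy, hyA⟩
          rcases Finset.mem_insert.1 hy with rfl | hy
          · exact .inl rfl
          · exact .inr ⟨hy, hyA⟩
        have h1 := Set.ncard_le_ncard this ((hfin A).insert x)
        have h2 := Set.ncard_insert_le x (↑X₁ ∩ A)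
        omega
      · have : ↑(insert x X₁) ∩ A = ↑X₁ ∩ A := by
          ext y
          simp only [Finset.coe_insert, Set.mem_inter_iff, Set.mem_insert_iff, Finset.mem_coe]
          constructor
          · rintro ⟨rfl | h, h'⟩
            · exact absurd h' hxA
            · exact ⟨h, h'⟩
          · exact fun h ↦ ⟨.inr h.1, h.2⟩
        rw [this]
        exact hcut A hA
    have := hmax (insert x X₁) ⟨by
      rw [Finset.coe_insert]; exact Set.insert_subset hx hX₁X, hins⟩
    rw [Finset.card_insert_of_notMem hx₁] at this
    omega
  refine ⟨X₁, hX₁X, hcut, X \ B, G.edgeBoundary B X, Set.sdiff_subset, G.edgeBoundary_subset B X,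
    ?_, ?_⟩
  · have h1 : X \ B ⊆ ↑X₁ \ B := fun x hx ↦ ⟨by
      by_contra h
      exact hx.2 (hXB ⟨hx.1, h⟩), hx.2⟩
    have h2 := Set.ncard_le_ncard h1 X₁.finite_toSet.sdiff
    have h3 := Set.ncard_inter_add_ncard_sdiff_eq_ncard (↑X₁ : Set α) B X₁.finite_toSet
    rw [Set.ncard_coe_finset] at h3
    have h4 := hB.2
    omega
  · rw [Set.disjoint_left]
    rintro v ⟨hcV, hv⟩ hvX
    have key : v ∉ B ∧ v ∉ X \ B := by
      clear hvX
      induction hv with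
      | refl => exact ⟨fun h ↦ (hB.1 h).2 rfl, fun h ↦ (hX h.1).2 rfl⟩
      | @tail u w _ huw ih =>
        obtain ⟨e, he⟩ := huw
        simp only [deleteEdges_isLink, deleteVerts_isLink] at he
        refine ⟨fun hw ↦ he.2 ⟨w, u, he.1.1.symm, hw, ih.1, fun hu ↦ ih.2 ⟨hu, ih.1⟩⟩, ?_⟩
        tauto
    exact key.2 ⟨hvX, key.1⟩

/-! ### Covering targets by a set with a small value of a submodular function -/

/-- Above every set there is one that is no more expensive, and cheaper than all sets strictly
above it. -/
lemma exists_strict_minimizer {Ω : Finset α} (φ : Finset α → ℕ) {U : Finset α} (hU : U ⊆ Ω) :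
    ∃ A ⊆ Ω, U ⊆ A ∧ φ A ≤ φ U ∧ ∀ C ⊆ Ω, A ⊂ C → φ A < φ C := by
  classical
  obtain ⟨A, hA, hmin⟩ := Finset.exists_min_image (Ω.powerset.filter fun A ↦ U ⊆ A)
    (fun A ↦ toLex (φ A, Ω.card - A.card)) ⟨U, by simp [hU]⟩
  simp only [Finset.mem_filter, Finset.mem_powerset, Prod.Lex.toLex_le_toLex] at hA hmin
  refine ⟨A, hA.1, hA.2, ?_, fun C hC hAC ↦ ?_⟩
  · rcases hmin U ⟨hU, subset_rfl⟩ with h | h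
    · exact h.le
    · exact h.1.le
  · rcases hmin C ⟨hC, hA.2.trans hAC.1⟩ with h | h
    · exact h
    · have h1 := Finset.card_lt_card hAC
      have h2 := Finset.card_le_card hC
      omega

/-- Let `φ` be a submodular function on the subsets of `Ω`, and let `A` be cheaper than every set
strictly above it. If every target outside `A` can be added to `A` at a cost of at most `l`,
then all of them can be added if the cost is allowed to grow by a factor of `k ^ l`.

A maximal family of pairwise disjoint extensions of `A` of cost at most `l` each has at most `φ A`
members. Adding all of them to `A` decreases the cost of covering any further target by at
least one, since a set that covers it must share with the family something outside `A`. -/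
lemma exists_cover {Ω T : Finset α} {φ : Finset α → ℕ} {k : ℕ} [DecidableEq α]
    (hsub : ∀ A ⊆ Ω, ∀ B ⊆ Ω, φ (A ∪ B) + φ (A ∩ B) ≤ φ A + φ B)
    (hfam : ∀ A ⊆ Ω, ∀ 𝒟 : Finset (Finset α),
      (∀ C ∈ 𝒟, A ⊆ C ∧ C ⊆ Ω ∧ φ C < φ A + k ∧ ∃ x ∈ T, x ∈ C ∧ x ∉ A) →
      (∀ C ∈ 𝒟, ∀ C' ∈ 𝒟, C ≠ C' → C ∩ C' ⊆ A) → 𝒟.card ≤ φ A) (l : ℕ) (hl : l < k) :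
    ∀ A ⊆ Ω, (∀ C ⊆ Ω, A ⊂ C → φ A < φ C) →
      (∀ x ∈ T, x ∉ A → ∃ C ⊆ Ω, A ⊆ C ∧ x ∈ C ∧ φ C ≤ φ A + l) →
      ∃ A' ⊆ Ω, T ⊆ A' ∧ φ A' ≤ k ^ l * φ A := by
  induction l with
  | zero =>
    intro A hA hmin hT
    refine ⟨A, hA, fun x hx ↦ ?_, by simp⟩
    by_contra hxA
    obtain ⟨C, hC, hAC, hxC, hle⟩ := hT x hx hxA
    have := hmin C hC ⟨hAC, fun h ↦ hxA (h hxC)⟩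
    omega
  | succ l ih =>
    intro A hA hmin hT
    let P : Finset α → Prop := fun C ↦ A ⊆ C ∧ C ⊆ Ω ∧ φ C ≤ φ A + (l + 1) ∧ ∃ x ∈ T, x ∈ C ∧ x ∉ A
    obtain ⟨𝒟, h𝒟, hmax⟩ := Finset.exists_max_image (Ω.powerset.powerset.filter fun 𝒟 ↦
      (∀ C ∈ 𝒟, P C) ∧ (∀ C ∈ 𝒟, ∀ C' ∈ 𝒟, C ≠ C' → C ∩ C' ⊆ A)) Finset.card ⟨∅, by simp⟩
    simp only [Finset.mem_filter, Finset.mem_powerset] at h𝒟 hmax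
    obtain ⟨h𝒟Ω, h𝒟P, h𝒟d⟩ := h𝒟
    have hcard : 𝒟.card ≤ φ A := hfam A hA 𝒟 (fun C hC ↦ by
      obtain ⟨h1, h2, h3, h4⟩ := h𝒟P C hC
      exact ⟨h1, h2, by omega, h4⟩) h𝒟d
    have hU : ∀ 𝒞 ⊆ 𝒟, A ∪ 𝒞.sup id ⊆ Ω ∧ φ (A ∪ 𝒞.sup id) ≤ φ A + 𝒞.card * (l + 1) := by
      intro 𝒞
      induction 𝒞 using Finset.induction_on with
      | empty => simp [hA]
      | insert C 𝒞 hC𝒞 ih' =>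
        intro hsub'
        obtain ⟨h1, h2⟩ := ih' ((Finset.subset_insert _ _).trans hsub')
        obtain ⟨hAC, hCΩ, hC, -⟩ := h𝒟P C (hsub' (Finset.mem_insert_self _ _))
        have heq : A ∪ (insert C 𝒞).sup id = (A ∪ 𝒞.sup id) ∪ C := by
          rw [Finset.sup_insert, id, Finset.sup_eq_union, Finset.union_comm C, Finset.union_assoc]
        rw [heq, Finset.card_insert_of_notMem hC𝒞]
        refine ⟨Finset.union_subset h1 hCΩ, ?_⟩
        have h3 := hsub _ h1 C hCΩ
        have h4 : φ A ≤ φ ((A ∪ 𝒞.sup id) ∩ C) := by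
          rcases (Finset.subset_inter Finset.subset_union_left hAC :
            A ⊆ (A ∪ 𝒞.sup id) ∩ C).eq_or_ssubset with h | h
          · rw [← h]
          · exact (hmin _ (Finset.inter_subset_right.trans hCΩ) h).le
        have h5 : (𝒞.card + 1) * (l + 1) = 𝒞.card * (l + 1) + (l + 1) := by ring
        omega
    obtain ⟨hUΩ, hUφ⟩ := hU 𝒟 subset_rfl
    have hUk : φ (A ∪ 𝒟.sup id) ≤ k * φ A := by
      calc φ (A ∪ 𝒟.sup id) ≤ φ A + 𝒟.card * (l + 1) := hUφ
        _ ≤ φ A + φ A * (l + 1) := Nat.add_le_add_left (Nat.mul_le_mul_right _ hcard) _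
        _ = (l + 2) * φ A := by ring
        _ ≤ k * φ A := Nat.mul_le_mul_right _ (by omega)
    obtain ⟨A₂, hA₂, hUA₂, hA₂φ, hA₂min⟩ := exists_strict_minimizer φ hUΩ
    have hAA₂ : A ⊆ A₂ := Finset.subset_union_left.trans hUA₂
    obtain ⟨A', hA', hTA', hA'φ⟩ := ih (by omega) A₂ hA₂ hA₂min (by
      intro x hxT hxA₂
      obtain ⟨C, hC, hAC, hxC, hle⟩ := hT x hxT fun h ↦ hxA₂ (hAA₂ h)
      refine ⟨A₂ ∪ C, Finset.union_subset hA₂ hC, Finset.subset_union_left,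
        Finset.mem_union_right _ hxC, ?_⟩
      have hin𝒟 : ∀ D ∈ 𝒟, D ⊆ A₂ := fun D hD ↦
        ((Finset.le_sup (f := id) hD).trans Finset.subset_union_right).trans hUA₂
      have hC𝒟 : C ∉ 𝒟 := fun h ↦ hxA₂ (hin𝒟 C h hxC)
      have hmeet : ∃ D ∈ 𝒟, ¬ C ∩ D ⊆ A := by
        by_contra! hno
        have := hmax (insert C 𝒟) ⟨?_, ?_, ?_⟩
        · rw [Finset.card_insert_of_notMem hC𝒟] at this
          omega
        · exact Finset.insert_subset (Finset.mem_powerset.2 hC) h𝒟Ω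
        · intro D hD
          rcases Finset.mem_insert.1 hD with rfl | hD
          · exact ⟨hAC, hC, hle, x, hxT, hxC, fun h ↦ hxA₂ (hAA₂ h)⟩
          · exact h𝒟P D hD
        · intro D hD D' hD' hne
          rcases Finset.mem_insert.1 hD with rfl | hD₂ <;>
          rcases Finset.mem_insert.1 hD' with rfl | hD₂'
          · exact absurd rfl hne
          · exact hno D' hD₂'
          · rw [Finset.inter_comm]; exact hno D hD₂
          · exact h𝒟d D hD₂ D' hD₂' hne
      obtain ⟨D, hD, hDA⟩ := hmeet
      have h1 : φ A < φ (A₂ ∩ C) := by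
        refine hmin _ (Finset.inter_subset_left.trans hA₂) ⟨Finset.subset_inter hAA₂ hAC, ?_⟩
        intro h
        refine hDA fun y hy ↦ h ?_
        rw [Finset.mem_inter] at hy ⊢
        exact ⟨hin𝒟 D hD hy.2, hy.1⟩
      have h2 := hsub A₂ hA₂ C hC
      omega)
    refine ⟨A', hA', hTA', hA'φ.trans ?_⟩
    calc k ^ l * φ A₂ ≤ k ^ l * (k * φ A) := Nat.mul_le_mul_left _ (hA₂φ.trans hUk)
      _ = k ^ (l + 1) * φ A := by ring

/-! ### Sources with `k` edge-disjoint paths each -/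

/-- Let every set that avoids `c` and meets `X₁` have an edge boundary of size at least `k`, and let
`A` be a set that avoids `c`. Pairwise disjoint extensions `C \ A` that meet `X₁` and that raise
`d(A) + k|X' \ A|` by less than `k` are at most as many as this value: each of them contains
an end of an edge on the boundary of `A`, or a vertex of `X' \ A`. -/
lemma card_extensions_le [DecidableEq α] {G : Graph α β} (hGE : E(G).Finite) {Ω X₁ X' A : Finset α}
    {k : ℕ} (hk : 0 < k)
    (hconn : ∀ B ⊆ Ω, (∃ x ∈ X₁, x ∈ B) → k ≤ (G.edgeBoundary ↑B ∅).ncard)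
    (𝒟 : Finset (Finset α))
    (h𝒟 : ∀ C ∈ 𝒟, A ⊆ C ∧ C ⊆ Ω ∧ (G.edgeBoundary ↑C ∅).ncard + k * (X' \ C).card <
      (G.edgeBoundary ↑A ∅).ncard + k * (X' \ A).card + k ∧ ∃ x ∈ X₁, x ∈ C ∧ x ∉ A)
    (hdisj : ∀ C ∈ 𝒟, ∀ C' ∈ 𝒟, C ≠ C' → C ∩ C' ⊆ A) :
    𝒟.card ≤ (G.edgeBoundary ↑A ∅).ncard + k * (X' \ A).card := by
  classical
  have hfin : ∀ B : Set α, (G.edgeBoundary B ∅).Finite := fun B ↦ finite_edgeBoundary hGE B ∅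
  let R : Finset α → β ⊕ α → Prop := fun C a ↦ match a with
    | .inl e => ∃ v, G.Inc e v ∧ v ∈ C ∧ v ∉ A
    | .inr x => x ∈ C
  let target : Finset (β ⊕ α) := (hfin A).toFinset.disjSum (X' \ A)
  have hex : ∀ C ∈ 𝒟, ∃ a ∈ target, R C a := by
    intro C hC
    obtain ⟨hAC, hCΩ, hlt, x, hx, hxC, hxA⟩ := h𝒟 C hC
    by_contra! hno
    have hnoE : ∀ e ∈ G.edgeBoundary ↑A ∅, ∀ v, G.Inc e v → v ∈ C → v ∈ A := by
      intro e he v hv hvC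
      by_contra hvA
      exact hno (.inl e) (Finset.inl_mem_disjSum.2 ((hfin A).mem_toFinset.2 he)) ⟨v, hv, hvC, hvA⟩
    have hX' : X' \ C = X' \ A := by
      ext y
      simp only [Finset.mem_sdiff]
      refine ⟨fun h ↦ ⟨h.1, fun h' ↦ h.2 (hAC h')⟩, fun h ↦ ⟨h.1, fun h' ↦ ?_⟩⟩
      exact hno (.inr y) (Finset.inr_mem_disjSum.2 (Finset.mem_sdiff.2 h)) h'
    rw [hX'] at hlt
    have hd : k ≤ (G.edgeBoundary ↑(C \ A) ∅).ncard :=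
      hconn _ (Finset.sdiff_subset.trans hCΩ) ⟨x, hx, Finset.mem_sdiff.2 ⟨hxC, hxA⟩⟩
    have hdis : Disjoint (G.edgeBoundary ↑A ∅) (G.edgeBoundary ↑(C \ A) ∅) := by
      rw [Set.disjoint_left]
      rintro e he ⟨u, v, hl, hu, -⟩
      have hu := Finset.mem_sdiff.1 (Finset.mem_coe.1 hu)
      exact hu.2 (hnoE e he u hl.inc_left hu.1)
    have hsub : G.edgeBoundary ↑A ∅ ∪ G.edgeBoundary ↑(C \ A) ∅ ⊆ G.edgeBoundary ↑C ∅ := by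
      rintro e (he | ⟨u, v, hl, hu, hv, -⟩)
      · obtain ⟨u, v, hl, hu, hv, -⟩ := id he
        exact ⟨u, v, hl, hAC hu, fun h ↦ hv (hnoE e he v hl.inc_right h), by simp⟩
      · have hu := Finset.mem_sdiff.1 (Finset.mem_coe.1 hu)
        refine ⟨u, v, hl, hu.1, fun hvC ↦ ?_, by simp⟩
        by_cases hvA : v ∈ A
        · exact hu.2 (hnoE e ⟨v, u, hl.symm, hvA, hu.2, by simp⟩ u hl.inc_left hu.1)
        · exact hv (Finset.mem_coe.2 (Finset.mem_sdiff.2 ⟨hvC, hvA⟩))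
    have := Set.ncard_le_ncard hsub (hfin C)
    rw [Set.ncard_union_eq hdis (hfin _) (hfin _)] at this
    omega
  have hsing : ∀ a ∈ target, ({C ∈ (𝒟 : Set (Finset α)) | R C a}).Subsingleton := by
    rintro a ha C ⟨hC, h1⟩ C' ⟨hC', h2⟩
    by_contra hne
    have hd := hdisj C hC C' hC' hne
    rcases a with e | x
    · obtain ⟨v, hv, hvC, hvA⟩ := h1
      obtain ⟨w, hw, hwC, hwA⟩ := h2
      obtain ⟨a, b, hl, ha, hb, -⟩ := (hfin A).mem_toFinset.1 (Finset.inl_mem_disjSum.1 ha)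
      have hvb : v = b := (hv.eq_or_eq_of_isLink hl).resolve_left (by rintro rfl; exact hvA ha)
      have hwb : w = b := (hw.eq_or_eq_of_isLink hl).resolve_left (by rintro rfl; exact hwA ha)
      subst hvb hwb
      exact hvA (hd (Finset.mem_inter.2 ⟨hvC, hwC⟩))
    · exact (Finset.mem_sdiff.1 (Finset.inr_mem_disjSum.1 ha)).2 (hd (Finset.mem_inter.2 ⟨h1, h2⟩))
  calc 𝒟.card ≤ target.card := 
      Finset.card_le_card_of_forall_subsingleton R hex hsing
    _ = (G.edgeBoundary ↑A ∅).ncard + (X' \ A).card := by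
      rw [Finset.card_disjSum, Set.ncard_eq_toFinset_card _ (hfin A)]
    _ ≤ _ := Nat.add_le_add_left (Nat.le_mul_of_pos_left _ hk) _

/-- If each vertex of `X₁` is joined to `c` by `k` edge-disjoint paths, and all of `X₁` is joined to
`c` by single edge-disjoint paths, then at least a fraction `k⁻ᵏ` of the vertices of `X₁` are joined
to `c` by `k` paths each, all of them edge-disjoint. -/
theorem exists_fan_sources {G : Graph α β} (hGV : V(G).Finite) (hGE : E(G).Finite) {c : α}
    {X₁ : Finset α} {k : ℕ} (hk : 0 < k)
    (hone : G.CutCondition c X₁ 1 ∅)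
    (hconn : ∀ B ⊆ V(G) \ {c}, (∃ x ∈ X₁, x ∈ B) → k ≤ (G.edgeBoundary B ∅).ncard) :
    ∃ X' ⊆ X₁, G.CutCondition c X' k ∅ ∧ X₁.card ≤ k ^ k * X'.card := by
  classical
  obtain ⟨X', hX', hmax⟩ := Finset.exists_max_image
    (X₁.powerset.filter fun S ↦ G.CutCondition c S k ∅) Finset.card
    ⟨∅, Finset.mem_filter.2 ⟨by simp, fun B _ ↦ by simp⟩⟩
  simp only [Finset.mem_filter, Finset.mem_powerset] at hX' hmax
  obtain ⟨hX'X₁, hcut⟩ := hX'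
  refine ⟨X', hX'X₁, hcut, ?_⟩
  have hΩf : (V(G) \ {c}).Finite := hGV.sdiff
  set Ω : Finset α := hΩf.toFinset with hΩ
  have hΩmem : ∀ {B : Finset α}, B ⊆ Ω → (B : Set α) ⊆ V(G) \ {c} := by
    intro B hB
    exact hΩf.subset_toFinset.1 hB
  have hcard : ∀ S B : Finset α, ((S : Set α) ∩ ↑B).ncard = (S ∩ B).card := by
    intro S B
    rw [← Finset.coe_inter, Set.ncard_coe_finset]
  let φ : Finset α → ℕ := fun A ↦ (G.edgeBoundary ↑A ∅).ncard + k * (X' \ A).card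
  have hφlow : ∀ A ⊆ Ω, k * X'.card ≤ φ A := by
    intro A hA
    have h1 := hcut _ (hΩmem hA)
    rw [hcard] at h1
    have h2 := Finset.card_inter_add_card_sdiff X' A
    calc k * X'.card = k * (X' ∩ A).card + k * (X' \ A).card := by rw [← h2]; ring
      _ ≤ φ A := Nat.add_le_add_right h1 _
  have hsub : ∀ A ⊆ Ω, ∀ B ⊆ Ω, φ (A ∪ B) + φ (A ∩ B) ≤ φ A + φ B := by
    intro A _ B _
    have h1 := ncard_edgeBoundary_submodular hGE (↑A : Set α) ↑B ∅
    rw [← Finset.coe_union, ← Finset.coe_inter] at h1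
    have h2 := Finset.card_union_add_card_inter (X' \ A) (X' \ B)
    rw [← Finset.sdiff_union_distrib, show X' \ A ∪ X' \ B = X' \ (A ∩ B) by
      ext; simp only [Finset.mem_union, Finset.mem_sdiff, Finset.mem_inter]; tauto] at h2
    have h3 : k * (X' \ (A ∪ B)).card + k * (X' \ (A ∩ B)).card =
        k * (X' \ A).card + k * (X' \ B).card := by
      rw [← mul_add, ← mul_add, ← h2, add_comm]
    simp only [φ]
    omega
  obtain ⟨A, hA, -, hAφ, hAmin⟩ := exists_strict_minimizer φ (Finset.empty_subset Ω)
  have hAφ : φ A ≤ k * X'.card := by simpa [φ, edgeBoundary_empty] using hAφ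
  obtain ⟨A', hA', hTA', hA'φ⟩ := exists_cover (T := X₁ \ X') hsub
    (fun A _ 𝒟 h1 h2 ↦ card_extensions_le hGE hk (fun B hB hBX ↦ hconn B (hΩmem hB) hBX) 𝒟
      (fun C hC ↦ by
        obtain ⟨a, b, c, x, hx, hxC⟩ := h1 C hC
        exact ⟨a, b, c, x, Finset.sdiff_subset hx, hxC⟩) h2) (k - 1) (by omega) A hA hAmin (by
    -- by maximality of `X'`, each target lies in a set that is expensive by less than `k`
    intro x hx hxA
    obtain ⟨hx₁, hx'⟩ := Finset.mem_sdiff.1 hx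
    have hnot : ¬ G.CutCondition c (insert x X') k ∅ := by
      intro h
      have := hmax _ ⟨Finset.insert_subset hx₁ hX'X₁, h⟩
      rw [Finset.card_insert_of_notMem hx'] at this
      omega
    simp only [CutCondition, not_forall, not_le] at hnot
    obtain ⟨W, hW, hlt⟩ := hnot
    lift W to Finset α using hΩf.subset hW
    have hWΩ : W ⊆ Ω := by rwa [hΩ, Set.Finite.subset_toFinset]
    rw [hcard] at hlt
    have hxW : x ∈ W := by
      by_contra hxW
      rw [Finset.insert_inter_of_notMem hxW, ← hcard] at hlt
      exact absurd (hcut _ hW) (by omega)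
    rw [Finset.insert_inter_of_mem hxW, Finset.card_insert_of_notMem (by simp [hx'])] at hlt
    refine ⟨A ∪ W, Finset.union_subset hA hWΩ, Finset.subset_union_left,
      Finset.mem_union_right _ hxW, ?_⟩
    have h1 := hsub A hA W hWΩ
    have h2 := hφlow (A ∩ W) (Finset.inter_subset_left.trans hA)
    have h3 := Finset.card_inter_add_card_sdiff X' W
    have h4 : φ W < k * X'.card + k := by
      calc φ W < k * ((X' ∩ W).card + 1) + k * (X' \ W).card := Nat.add_lt_add_right hlt _
        _ = k * X'.card + k := by rw [← h3]; ring
    omega)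
  have h1 := hone _ (hΩmem hA')
  rw [hcard, one_mul] at h1
  have h2 : X₁ \ A' ⊆ X' \ A' := by
    intro x hx
    rw [Finset.mem_sdiff] at hx ⊢
    refine ⟨?_, hx.2⟩
    by_contra hx'
    exact hx.2 (hTA' (Finset.mem_sdiff.2 ⟨hx.1, hx'⟩))
  calc X₁.card = (X₁ ∩ A').card + (X₁ \ A').card := (Finset.card_inter_add_card_sdiff _ _).symm
    _ ≤ (G.edgeBoundary ↑A' ∅).ncard + k * (X' \ A').card :=
      Nat.add_le_add h1 ((Finset.card_le_card h2).trans (Nat.le_mul_of_pos_left _ hk))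
    _ ≤ k ^ (k - 1) * φ A := hA'φ
    _ ≤ k ^ (k - 1) * (k * X'.card) := Nat.mul_le_mul_left _ hAφ
    _ = k ^ k * X'.card := by
      rw [← mul_assoc, ← pow_succ, Nat.sub_add_cancel hk]

/-! ### Stable matchings -/

section Stable

variable {K I Z L : Type*} (prop : K → I) (rec : K → Z) (s : K → ℕ)

/-- The contracts that are offered by the proposers in `T` once the contracts in `R` have been
rejected: each proposer goes through its contracts in the order of `s`. -/
def offers (T : Set I) (R : Set K) : Set K :=
  {κ | prop κ ∈ T ∧ ∀ κ', prop κ' = prop κ → s κ' < s κ → κ' ∈ R}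

/-- One round of deferred acceptance: every receiver rejects all contracts offered to it but the one
of the greatest value of `w`. -/
def rejections [LinearOrder L] (w : K → L) (T : Set I) : Set K →o Set K where
  toFun R := {κ | κ ∈ offers prop s T R ∧
    ∃ κ' ∈ offers prop s T R, rec κ' = rec κ ∧ w κ < w κ'}
  monotone' := by
    have hmono : ∀ R R' : Set K, R ⊆ R' → offers prop s T R ⊆ offers prop s T R' :=
      fun R R' h κ hκ ↦ ⟨hκ.1, fun κ' h1 h2 ↦ h (hκ.2 κ' h1 h2)⟩
    rintro R R' h κ ⟨h1, κ', h2, h3⟩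
    exact ⟨hmono R R' h h1, κ', hmono R R' h h2, h3⟩

/-- Deferred acceptance for a set `T` of proposers that varies. A proposer prefers contracts with a
small value of `s`, a receiver those with a large value of `w`. The set `O T` of contracts that are
ever offered grows with `T`. Each proposer in `T` either offers all its contracts, or the last
contract that it offers is the best one offered to the receiver of that contract. The best contract
offered to a receiver is the last one of its proposer, so that no more than `|T|` receivers
get any offer at all. -/
theorem exists_deferred_acceptance [Finite K] [LinearOrder L] (w : K → L)
    (hs : ∀ κ κ', prop κ = prop κ' → s κ = s κ' → κ = κ') :
    ∃ O : Set I → Set K, Monotone O ∧ ∀ T,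
      (∀ κ ∈ O T, ∀ κ', prop κ' = prop κ → s κ' ≤ s κ → κ' ∈ O T) ∧
      (∀ i ∈ T, (∀ κ, prop κ = i → κ ∈ O T) ∨
        ∃ κ ∈ O T, prop κ = i ∧ ∀ κ' ∈ O T, rec κ' = rec κ → w κ' ≤ w κ) ∧
      (∀ κ ∈ O T, (∀ κ' ∈ O T, rec κ' = rec κ → w κ' ≤ w κ) →
        ∀ κ' ∈ O T, prop κ' = prop κ → s κ' ≤ s κ) ∧
      (T.Finite → (rec '' O T).ncard ≤ T.ncard) := by
  classical
  let F : Set I → Set K →o Set K := rejections prop rec s w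
  let R : Set I → Set K := fun T ↦ (F T).lfp
  have hR : ∀ T κ, κ ∈ R T ↔ κ ∈ offers prop s T (R T) ∧
      ∃ κ' ∈ offers prop s T (R T), rec κ' = rec κ ∧ w κ < w κ' := by
    intro T κ
    conv_lhs => rw [show R T = F T (R T) from ((F T).map_lfp).symm]
    rfl
  have hF : ∀ T T', T ⊆ T' → F T ≤ F T' := by
    rintro T T' h R₀ κ ⟨h1, κ', h2, h3⟩
    exact ⟨⟨h h1.1, h1.2⟩, κ', ⟨h h2.1, h2.2⟩, h3⟩
  have hlast : ∀ T, ∀ κ ∈ offers prop s T (R T),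
      (∀ κ' ∈ offers prop s T (R T), rec κ' = rec κ → w κ' ≤ w κ) →
        ∀ κ' ∈ offers prop s T (R T), prop κ' = prop κ → s κ' ≤ s κ := by
    intro T κ _ hbest κ' hκ' hp
    by_contra! hlt
    obtain ⟨-, κ₂, h2, h3, h4⟩ := (hR T κ).1 (hκ'.2 κ hp.symm hlt)
    exact absurd (hbest κ₂ h2 h3) (not_le.2 h4)
  refine ⟨fun T ↦ offers prop s T (R T), ?_, fun T ↦ ⟨?_, ?_, hlast T, ?_⟩⟩
  · intro T T' h κ hκ
    exact ⟨h hκ.1, fun κ' h1 h2 ↦ OrderHom.lfp.monotone (hF T T' h) (hκ.2 κ' h1 h2)⟩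
  · intro κ hκ κ' hp hle
    refine ⟨by rw [hp]; exact hκ.1, fun κ₂ h1 h2 ↦ hκ.2 κ₂ (h1.trans hp) (by omega)⟩
  · intro i hi
    by_cases hall : ∀ κ, prop κ = i → κ ∈ R T
    · exact .inl fun κ hκ ↦ ((hR T κ).1 (hall κ hκ)).1
    · push Not at hall
      obtain ⟨κ, ⟨hκi, hκ⟩, hmin⟩ := exists_minimalFor_of_wellFoundedLT
        (fun κ ↦ prop κ = i ∧ κ ∉ R T) s hall
      have hoff : κ ∈ offers prop s T (R T) := by
        refine ⟨by rw [hκi]; exact hi, fun κ' h1 h2 ↦ ?_⟩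
        by_contra hκ'
        have := hmin ⟨h1.trans hκi, hκ'⟩ h2.le
        omega
      refine .inr ⟨κ, hoff, hκi, fun κ' h1 h2 ↦ ?_⟩
      by_contra! hlt
      exact hκ ((hR T κ).2 ⟨hoff, κ', h1, h2, hlt⟩)
  · intro hT
    have hbest : ∀ z ∈ rec '' offers prop s T (R T), ∃ κ ∈ offers prop s T (R T), rec κ = z ∧
        ∀ κ' ∈ offers prop s T (R T), rec κ' = rec κ → w κ' ≤ w κ := by
      rintro _ ⟨κ₀, h0, rfl⟩
      obtain ⟨κ, hκ, hmax⟩ := Set.exists_max_image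
        {κ | κ ∈ offers prop s T (R T) ∧ rec κ = rec κ₀} w (Set.toFinite _) ⟨κ₀, h0, rfl⟩
      exact ⟨κ, hκ.1, hκ.2, fun κ' h1 h2 ↦ hmax κ' ⟨h1, h2.trans hκ.2⟩⟩
    rcases isEmpty_or_nonempty K with hK | hK
    · have hempty : rec '' offers prop s T (R T) = ∅ := by
        rw [Set.eq_empty_of_isEmpty (offers prop s T (R T)), Set.image_empty]
      change (rec '' offers prop s T (R T)).ncard ≤ T.ncard
      simp [hempty]
    · choose! b hb hbz hbest using hbest
      refine Set.ncard_le_ncard_of_injOn (fun z ↦ prop (b z)) (fun z hz ↦ (hb z hz).1) ?_ hT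
      intro z hz z' hz' heq
      have h1 := hlast T _ (hb z hz) (hbest z hz) _ (hb z' hz') heq.symm
      have h2 := hlast T _ (hb z' hz') (hbest z' hz') _ (hb z hz) heq
      have := hs _ _ heq (le_antisymm h2 h1)
      rw [← hbz z hz, ← hbz z' hz', this]

end Stable

/-! ### Rerouting paths so that they avoid most branch vertices -/

section Reroute

variable {G : Graph α β} {c : α} {S : Finset α} {k : ℕ}

/-- The paths `r i` and `p z` meet: either vertex `j` of `r i` is the first vertex of `p z`, or edge
`j` of `r i` is edge `m` of `p z`. The time of the meeting on `r i` is `2 * j` or `2 * j + 1`, so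
that vertices and edges are ordered along `r i`; its position on `p z` is `0` or `m + 1`. -/
def Meets (r : ∀ i : S × Fin k, G.SimplePath (i.1 : α) c) (p : ∀ z : S, G.SimplePath (z : α) c)
    (i : S × Fin k) (t : ℕ) (z : S) (l : ℕ) : Prop :=
  (∃ j ≤ (r i).length, t = 2 * j ∧ (r i).vert j = z ∧ l = 0) ∨
    ∃ j < (r i).length, ∃ m < (p z).length, t = 2 * j + 1 ∧ (r i).edge j = (p z).edge m ∧ l = m + 1

/-- Let all the paths `r i` be edge-disjoint, and let the paths `p z` be edge-disjoint and avoid `S`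
except for their first vertices. For `T ⊆ S`, the paths `r i` that start in `T` can be
rerouted along paths `p z` so that they stay edge-disjoint and meet only few vertices
of `S`: those in a set `V T` that is monotone in `T` and has at most `k * |T|` elements. The
conclusion is recorded in terms of cuts.

The rerouting is a stable matching. A path `r i` prefers to switch early, and `p z` prefers
to be entered late. If an edge that `r i` uses before its switch were used by another path that has
entered `p z`, then `r i` would have switched to `p z` there. Every vertex `z ∈ S` that is met
receives an offer, namely to enter `p z` at its first vertex. -/
theorem exists_reroute (hGE : E(G).Finite)
    (r : ∀ i : S × Fin k, G.SimplePath (i.1 : α) c)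
    (hr : ∀ i j, i ≠ j → Disjoint (r i).edges (r j).edges)
    (p : ∀ z : S, G.SimplePath (z : α) c)
    (hp : ∀ z z', z ≠ z' → Disjoint (p z).edges (p z').edges)
    (hpS : ∀ z, ∀ j, 0 < j → j ≤ (p z).length → (p z).vert j ∉ S) :
    ∃ V : Set S → Set S, Monotone V ∧ (∀ T, (V T).ncard ≤ k * T.ncard) ∧
      ∀ (T : Set S) (B Y : Set α), c ∉ B → (∀ x ∈ T, (x : α) ∈ B) → Y ⊆ S →
        (∀ y ∈ V T, (y : α) ∉ Y) → k * T.ncard ≤ (G.edgeBoundary B Y).ncard := by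
  classical
  let K := {q : (S × Fin k) × ℕ × S × ℕ // Meets r p q.1 q.2.1 q.2.2.1 q.2.2.2}
  have hKfin : Finite K := by
    obtain ⟨M, hM⟩ := (Set.finite_range fun i ↦ (r i).length).bddAbove
    obtain ⟨N, hN⟩ := (Set.finite_range fun z ↦ (p z).length).bddAbove
    have hsub : {q : (S × Fin k) × ℕ × S × ℕ | Meets r p q.1 q.2.1 q.2.2.1 q.2.2.2} ⊆
        Set.univ ×ˢ Set.Iic (2 * M + 1) ×ˢ Set.univ ×ˢ Set.Iic (N + 1) := by
      rintro ⟨i, t, z, l⟩ h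
      have h1 := hM ⟨i, rfl⟩
      have h2 := hN ⟨z, rfl⟩
      simp only at h1 h2
      simp only [Set.mem_prod, Set.mem_univ, Set.mem_Iic, true_and]
      simp only [Set.mem_ofPred_eq, Meets] at h
      rcases h with ⟨j, hj, h3, -, h4⟩ | ⟨j, hj, m, hm, h3, -, h4⟩ <;> omega
    exact (Set.finite_univ.prod ((Set.finite_Iic _).prod
      (Set.finite_univ.prod (Set.finite_Iic _)))).subset hsub
  obtain ⟨code, hcode⟩ := exists_injective_nat K
  let prop : K → S × Fin k := fun κ ↦ κ.1.1
  let time : K → ℕ := fun κ ↦ κ.1.2.1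
  let rec' : K → S := fun κ ↦ κ.1.2.2.1
  let pos : K → ℕ := fun κ ↦ κ.1.2.2.2
  let w : K → ℕ ×ₗ ℕ := fun κ ↦ toLex (pos κ, code κ)
  have hw : Function.Injective w := by
    intro κ κ' h
    have := congrArg (fun a ↦ (ofLex a).2) h
    exact hcode this
  have hwpos : ∀ κ κ', w κ ≤ w κ' → pos κ ≤ pos κ' := by
    intro κ κ' h
    rcases Prod.Lex.toLex_le_toLex.1 h with h | h
    · exact h.le
    · exact h.1.le
  have hs : ∀ κ κ', prop κ = prop κ' → time κ = time κ' → κ = κ' := by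
    rintro ⟨⟨i, t, z, l⟩, h⟩ ⟨⟨i', t', z', l'⟩, h'⟩ hi ht
    simp only [prop, time] at hi ht
    subst hi ht
    rw [Subtype.mk.injEq]
    suffices z = z' ∧ l = l' by rw [this.1, this.2]
    simp only [Meets] at h h'
    rcases h with ⟨j, hj, h1, h2, h3⟩ | ⟨j, hj, m, hm, h1, h2, h3⟩ <;>
    rcases h' with ⟨j', hj', h1', h2', h3'⟩ | ⟨j', hj', m', hm', h1', h2', h3'⟩
    · obtain rfl : j = j' := by omega
      exact ⟨Subtype.ext (h2.symm.trans h2'), by omega⟩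
    · omega
    · omega
    · obtain rfl : j = j' := by omega
      have hz : z = z' := by
        by_contra hne
        exact Set.disjoint_left.1 (hp z z' hne) ⟨m, hm, h2.symm⟩ ⟨m', hm', h2'.symm⟩
      subst hz
      have := (p z).edge_inj hm hm' (h2.symm.trans h2')
      exact ⟨rfl, by omega⟩
  obtain ⟨O, hOmono, hO⟩ := exists_deferred_acceptance prop rec' time w hs
  let I : Set S → Set (S × Fin k) := fun T ↦ T ×ˢ Set.univ
  have hIcard : ∀ T, (I T).ncard = k * T.ncard := by
    intro T
    rw [Set.ncard_prod, Set.ncard_univ, Nat.card_eq_fintype_card, Fintype.card_fin, mul_comm]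
  refine ⟨fun T ↦ rec' '' O (I T), ?_, ?_, ?_⟩
  · intro T T' h
    exact Set.image_mono (hOmono (Set.prod_mono h subset_rfl))
  · intro T
    rw [← hIcard]
    exact (hO (I T)).2.2.2 (Set.toFinite _)
  intro T B Y hcB hTB hYS hVY
  obtain ⟨hdown, hmatch, -, -⟩ := hO (I T)
  have hmet : ∀ i j (hj : j ≤ (r i).length) (hv : (r i).vert j ∈ S),
      (⟨(i, 2 * j, ⟨_, hv⟩, 0), .inl ⟨j, hj, rfl, rfl, rfl⟩⟩ : K) ∈ O (I T) →
      (r i).vert j ∉ Y := fun i j hj hv h ↦ hVY ⟨_, hv⟩ ⟨_, h, rfl⟩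
  -- the edge `f` is used by the rerouted path `i`, either before or after the switch
  let Uses : S × Fin k → β → Prop := fun i f ↦
    (∃ j < (r i).length, (r i).edge j = f ∧
      ∀ κ, prop κ = i → time κ ≤ 2 * j + 1 → κ ∈ O (I T)) ∨
    ∃ κ ∈ O (I T), prop κ = i ∧ (∀ κ' ∈ O (I T), rec' κ' = rec' κ → w κ' ≤ w κ) ∧
      ∃ m < (p (rec' κ)).length, (p (rec' κ)).edge m = f ∧ pos κ ≤ m + 1
  have hcross : ∀ i ∈ I T, ∃ f ∈ G.edgeBoundary B Y, Uses i f := by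
    rintro i ⟨hi, -⟩
    have hstart : (r i).vert 0 ∈ B := by rw [(r i).vert_zero]; exact hTB _ hi
    rcases hmatch i ⟨hi, trivial⟩ with hall | ⟨κ, hκ, hκi, hbest⟩
    · obtain ⟨j, -, hj, hjB, hj'⟩ := SimplePath.exists_leaving (Nat.zero_le (r i).length) hstart
        (by rw [(r i).vert_length]; exact hcB)
      refine ⟨(r i).edge j, ⟨_, _, (r i).isLink j hj, hjB, hj', fun hY ↦ ?_⟩,
        .inl ⟨j, hj, rfl, fun κ h _ ↦ hall κ h⟩⟩
      exact hmet i (j + 1) hj (hYS hY) (hall _ rfl) hY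
    · obtain ⟨j₀, hj₀, hj₀t, hz⟩ : ∃ j₀ ≤ (r i).length, 2 * j₀ ≤ time κ ∧
          ((r i).vert j₀ ∈ B → ∃ m ≤ (p (rec' κ)).length, (p (rec' κ)).vert m ∈ B ∧
            pos κ ≤ m + 1) := by
        obtain ⟨⟨i', t, z, l⟩, h⟩ := κ
        simp only [prop] at hκi
        subst hκi
        rcases h with ⟨j, hj, h1, h2, h3⟩ | ⟨j, hj, m, hm, h1, h2, h3⟩ <;> simp only at h1 h2 h3 hj
        · refine ⟨j, hj, h1.ge, fun hB ↦ ⟨0, Nat.zero_le _, ?_, by simp only [pos]; omega⟩⟩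
          rw [(p _).vert_zero]
          simp only [rec']
          rwa [← h2]
        · refine ⟨j, hj.le, by simp only [time]; omega, fun hB ↦ ?_⟩
          have hl := (r i').isLink j hj
          rw [h2] at hl
          rcases hl.left_eq_or_eq ((p z).isLink m hm) with h4 | h4
          · exact ⟨m, hm.le, by simp only [rec']; rwa [← h4], by simp only [pos]; omega⟩
          · exact ⟨m + 1, hm, by simp only [rec']; rwa [← h4], by simp only [pos]; omega⟩
      by_cases hB : (r i).vert j₀ ∈ B
      · obtain ⟨m₁, hm₁, hm₁B, hm₁l⟩ := hz hB
        obtain ⟨m, hm, hml, hmB, hmB'⟩ := SimplePath.exists_leaving hm₁ hm₁B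
          (by rw [(p _).vert_length]; exact hcB)
        exact ⟨(p (rec' κ)).edge m, ⟨_, _, (p _).isLink m hml, hmB, hmB',
          fun hY ↦ hpS _ (m + 1) (by omega) hml (hYS hY)⟩,
          .inr ⟨κ, hκ, hκi, hbest, m, hml, rfl, by omega⟩⟩
      · obtain ⟨j, -, hj, hjB, hjB'⟩ := SimplePath.exists_leaving (Nat.zero_le j₀) hstart hB
        refine ⟨(r i).edge j, ⟨_, _, (r i).isLink j (by omega), hjB, hjB', fun hY ↦ ?_⟩,
          .inl ⟨j, by omega, rfl, fun κ' h1 h2 ↦ hdown κ hκ κ' (h1.trans hκi.symm) (by omega)⟩⟩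
        exact hmet i (j + 1) (by omega) (hYS hY)
          (hdown κ hκ _ hκi.symm (show 2 * (j + 1) ≤ time κ by omega)) hY
  have hmixed : ∀ i i' f, (∃ j < (r i).length, (r i).edge j = f ∧
      ∀ κ, prop κ = i → time κ ≤ 2 * j + 1 → κ ∈ O (I T)) →
      (∃ κ ∈ O (I T), prop κ = i' ∧ (∀ κ' ∈ O (I T), rec' κ' = rec' κ → w κ' ≤ w κ) ∧
        ∃ m < (p (rec' κ)).length, (p (rec' κ)).edge m = f ∧ pos κ ≤ m + 1) → i = i' := by
    rintro i i' f ⟨j, hj, rfl, hoff⟩ ⟨κ, hκ, hκi, hbest, m, hm, hf, hpos⟩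
    let κ₀ : K := ⟨(i, 2 * j + 1, rec' κ, m + 1), .inr ⟨j, hj, m, hm, rfl, hf.symm, rfl⟩⟩
    have h1 : m + 1 ≤ pos κ := hwpos κ₀ κ (hbest κ₀ (hoff κ₀ rfl le_rfl) rfl)
    obtain ⟨⟨i₂, t, z, l⟩, h⟩ := κ
    simp only [prop, rec', pos] at hκi hf hm h1 hpos
    subst hκi
    rcases h with ⟨j', hj', -, -, h2⟩ | ⟨j', hj', m', hm', -, h2, h3⟩ <;> simp only at *
    · omega
    · obtain rfl : m = m' := by omega
      by_contra hne
      exact Set.disjoint_left.1 (hr i i₂ hne) ⟨j, hj, rfl⟩ ⟨j', hj', h2.trans hf⟩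
  have huses : ∀ i i' f, Uses i f → Uses i' f → i = i' := by
    rintro i i' f (h | h) (h' | h')
    · obtain ⟨j, hj, hf, -⟩ := h
      obtain ⟨j', hj', hf', -⟩ := h'
      by_contra hne
      exact Set.disjoint_left.1 (hr i i' hne) ⟨j, hj, hf⟩ ⟨j', hj', hf'⟩
    · exact hmixed i i' f h h'
    · exact (hmixed i' i f h' h).symm
    · obtain ⟨κ, hκ, rfl, hbest, m, hm, hf, -⟩ := h
      obtain ⟨κ', hκ', rfl, hbest', m', hm', hf', -⟩ := h'
      have hz : rec' κ = rec' κ' := by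
        by_contra hne
        exact Set.disjoint_left.1 (hp _ _ hne) ⟨m, hm, hf⟩ ⟨m', hm', hf'⟩
      rw [hw (le_antisymm (hbest' κ hκ hz) (hbest κ' hκ' hz.symm))]
  rw [← hIcard]
  rcases (I T).eq_empty_or_nonempty with hemp | ⟨i₀, hi₀⟩
  · simp [hemp]
  obtain ⟨f₀, -⟩ := hcross i₀ hi₀
  have : Nonempty β := ⟨f₀⟩
  choose! f hf hfU using hcross
  exact Set.ncard_le_ncard_of_injOn f hf
    (fun i hi i' hi' heq ↦ huses i i' (f i) (hfU i hi) (heq ▸ hfU i' hi'))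
    (finite_edgeBoundary hGE B Y)

end Reroute

/-! ### Choosing branch vertices that are not met -/

/-- If `V` is monotone and `|V T| ≤ k * |T|`, then some set `S` of at least a fraction `1 / (4k +
2)` of the elements is such that no `z ∈ S` lies in `V (S \ {z})`. Half of the elements of a
suitable set of size `2n` will do: on average over all sets `S` of this size, at most half of the `z
∈ S` lie in `V (S \ {z})`. -/
theorem exists_independent {A : Type*} [Fintype A] [DecidableEq A] {V : Set A → Set A}
    (hV : Monotone V) {k n : ℕ} (hVcard : ∀ T, (V T).ncard ≤ k * T.ncard)
    (hn : (4 * k + 2) * n ≤ Fintype.card A) :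
    ∃ S : Finset A, n ≤ S.card ∧ ∀ z ∈ S, z ∉ V ↑(S.erase z) := by
  classical
  obtain rfl | hn0 := Nat.eq_zero_or_pos n
  · exact ⟨∅, by simp⟩
  let bad : Finset A → Finset A := fun S ↦ S.filter fun z ↦ z ∈ V ↑(S.erase z)
  obtain ⟨m, hm⟩ : ∃ m, 2 * n = m + 1 := ⟨2 * n - 1, by omega⟩
  obtain ⟨S, hS, hbad⟩ : ∃ S : Finset A, S.card = 2 * n ∧ (bad S).card ≤ n := by
    by_contra! hall
    let P : ℕ → Finset (Finset A) := fun s ↦ Finset.powersetCard s Finset.univ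
    have hP : ∀ s, (P s).card = (Fintype.card A).choose s := fun s ↦ by
      rw [Finset.card_powersetCard, Finset.card_univ]
    have hfin : ∀ T, (V T).Finite := fun T ↦ Set.toFinite _
    have hcount : ((P (m + 1)).sigma bad).card ≤
        ((P m).sigma fun T ↦ (hfin ↑T).toFinset).card := by
      refine Finset.card_le_card_of_injOn (fun q ↦ ⟨q.1.erase q.2, q.2⟩) ?_ ?_
      · rintro ⟨S, z⟩ h
        simp only [P, bad, Finset.coe_sigma, Set.mem_sigma_iff, Finset.mem_coe,
          Finset.mem_powersetCard_univ, Finset.mem_filter] at h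
        simp only [P, Finset.coe_sigma, Set.mem_sigma_iff, Finset.mem_coe,
          Finset.mem_powersetCard_univ, Set.Finite.mem_toFinset]
        exact ⟨by rw [Finset.card_erase_of_mem h.2.1, h.1, Nat.add_sub_cancel], h.2.2⟩
      · rintro ⟨S, z⟩ h ⟨S', z'⟩ h' heq
        simp only [bad, Finset.coe_sigma, Set.mem_sigma_iff, Finset.mem_coe,
          Finset.mem_filter] at h h'
        simp only [Sigma.mk.injEq, heq_eq_eq] at heq
        obtain ⟨h1, rfl⟩ := heq
        have : S = S' := by
          rw [← Finset.insert_erase h.2.1, h1, Finset.insert_erase h'.2.1]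
        rw [this]
    rw [Finset.card_sigma, Finset.card_sigma] at hcount
    have hlow : (P (m + 1)).card * (n + 1) ≤ ∑ S ∈ P (m + 1), (bad S).card :=
      Finset.card_nsmul_le_sum (P (m + 1)) (fun S ↦ (bad S).card) (n + 1) fun S hS ↦
        hall S (by rw [hm]; exact Finset.mem_powersetCard_univ.1 hS)
    have hupp : ∑ T ∈ P m, (hfin ↑T).toFinset.card ≤ (P m).card * (k * m) :=
      Finset.sum_le_card_nsmul (P m) (fun T ↦ (hfin ↑T).toFinset.card) (k * m) fun T hT ↦ by
        rw [← Set.ncard_eq_toFinset_card]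
        refine (hVcard ↑T).trans ?_
        rw [Set.ncard_coe_finset, Finset.mem_powersetCard_univ.1 hT]
    have h1 := (hlow.trans hcount).trans hupp
    rw [hP, hP] at h1
    have h2 := Nat.choose_succ_right_eq (Fintype.card A) m
    set N := Fintype.card A with hN
    have hmN : m ≤ N := by nlinarith
    have hpos : 0 < N.choose m := Nat.choose_pos hmN
    have h3 : N.choose m * ((N - m) * (n + 1)) ≤ N.choose m * (k * m * (m + 1)) := by
      calc N.choose m * ((N - m) * (n + 1)) = N.choose (m + 1) * (n + 1) * (m + 1) := by
            rw [← mul_assoc, ← h2]; ring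
        _ ≤ N.choose m * (k * m) * (m + 1) := Nat.mul_le_mul_right _ h1
        _ = _ := by ring
    have h4 := Nat.le_of_mul_le_mul_left h3 hpos
    have h5 : 4 * k * n + 1 ≤ N - m := by
      have : (4 * k + 2) * n = 4 * k * n + 2 * n := by ring
      omega
    have h6 : k * m * (m + 1) ≤ 4 * k * n * n := by
      calc k * m * (m + 1) ≤ k * (2 * n) * (2 * n) :=
            Nat.mul_le_mul (Nat.mul_le_mul_left _ (by omega)) hm.ge
        _ = _ := by ring
    nlinarith [Nat.mul_le_mul_right (n + 1) h5]
  refine ⟨S \ bad S, ?_, fun z hz hzV ↦ ?_⟩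
  · have hbS : bad S ⊆ S := Finset.filter_subset _ S
    have := Finset.card_sdiff_add_card_eq_card hbS
    omega
  · rw [Finset.mem_sdiff] at hz
    refine hz.2 (Finset.mem_filter.2 ⟨hz.1, hV ?_ hzV⟩)
    exact Finset.coe_subset.2 (Finset.erase_subset_erase _ Finset.sdiff_subset)

/-- Let `k` edge-disjoint paths run from each vertex of `S` to `c`, and let the vertices of `S` also
be joined to `c` by single edge-disjoint paths that have no inner vertex in `S`. Then the cut
condition for `k` paths from each branch vertex, with no branch vertex inside of a path, holds for a
set `S'` of at least a fraction `1 / (4k + 2)` of the vertices of `S`.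

The cut condition for `B` concerns the paths that start in `T = S' ∩ B`, rerouted as in
`Graph.exists_reroute`: they avoid each `z ∈ S' \ B`, as `V T ⊆ V (S' \ {z})`. -/
theorem exists_spider_sources {G : Graph α β} (hGE : E(G).Finite) {c : α} {S : Finset α}
    (hSV : ↑S ⊆ V(G) \ {c}) {k n : ℕ} (hfan : G.CutCondition c S k ∅)
    (hstar : G.CutCondition c S 1 ↑S) (hn : (4 * k + 2) * n ≤ S.card) :
    ∃ S' ⊆ S, n ≤ S'.card ∧ G.CutCondition c S' k ↑S' := by
  classical
  obtain ⟨r, hr, -⟩ := hfan.exists_linkage hGE hSV (by simp)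
  obtain ⟨p, hp, hpS⟩ := hstar.exists_linkage hGE hSV (fun h ↦ (hSV h).2 rfl)
  obtain ⟨V, hV, hVcard, hcut⟩ := exists_reroute hGE r hr (fun z ↦ p (z, 0))
    (fun z z' hne ↦ hp _ _ fun h ↦ hne (congrArg Prod.fst h)) (fun z ↦ hpS (z, 0))
  obtain ⟨S₀, hS₀n, hS₀⟩ := exists_independent hV hVcard (by rwa [Fintype.card_coe])
  refine ⟨S₀.map (Function.Embedding.subtype _), ?_, by rwa [Finset.card_map], ?_⟩
  · intro x hx
    obtain ⟨z, -, rfl⟩ := Finset.mem_map.1 hx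
    exact z.2
  intro B hB
  set S' : Finset α := S₀.map (Function.Embedding.subtype _) with hS'
  have hmem : ∀ x, x ∈ S' ↔ ∃ z ∈ S₀, (z : α) = x := by
    intro x; simp [hS']
  let T : Set S := {z | z ∈ S₀ ∧ (z : α) ∈ B}
  have hT : ((↑S' : Set α) ∩ B).ncard = T.ncard := by
    rw [← Set.ncard_image_of_injective T Subtype.val_injective]
    congr 1
    ext x
    simp only [Set.mem_inter_iff, Finset.mem_coe, hmem, Set.mem_image, T]
    constructor
    · rintro ⟨⟨z, hz, rfl⟩, hB⟩
      exact ⟨z, ⟨hz, hB⟩, rfl⟩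
    · rintro ⟨z, ⟨hz, hB⟩, rfl⟩
      exact ⟨⟨z, hz, rfl⟩, hB⟩
  rw [hT]
  refine (hcut T B (↑S' \ B) (fun h ↦ (hB h).2 rfl) (fun x hx ↦ hx.2) ?_ ?_).trans
    (Set.ncard_le_ncard ?_ (finite_edgeBoundary hGE _ _))
  · rintro x ⟨hx, -⟩
    obtain ⟨z, -, rfl⟩ := (hmem x).1 hx
    exact z.2
  · rintro y hyV ⟨hy, hyB⟩
    obtain ⟨z, hz, hzy⟩ := (hmem y).1 hy
    obtain rfl : z = y := Subtype.ext hzy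
    refine hS₀ z hz (hV ?_ hyV)
    intro x hx
    exact Finset.mem_coe.2 (Finset.mem_erase.2 ⟨fun h ↦ hyB (h ▸ hx.2), hx.1⟩)
  · rintro e ⟨u, v, hl, hu, hv, hvY⟩
    exact ⟨u, v, hl, hu, hv, fun h ↦ hvY ⟨h, hv⟩⟩

/-! ### Connected subgraphs and cycles from paths -/

/-- The subgraph of `G` whose vertices are those of `G` in `W` and whose edges are those in `D` with
both ends in `W`. -/
def part (G : Graph α β) (W : Set α) (D : Set β) : Graph α β :=
  (G.induce (V(G) ∩ W)).restrict D

lemma part_isLink {G : Graph α β} {W : Set α} {D : Set β} {e : β} {u v : α} :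
    (G.part W D).IsLink e u v ↔ e ∈ D ∧ G.IsLink e u v ∧ u ∈ W ∧ v ∈ W := by
  simp only [part, restrict_isLink, induce_isLink]
  constructor
  · rintro ⟨h1, h2, h3, h4⟩
    exact ⟨h1, h2, h3.2, h4.2⟩
  · rintro ⟨h1, h2, h3, h4⟩
    exact ⟨h1, h2, ⟨h2.left_mem, h3⟩, ⟨h2.right_mem, h4⟩⟩

lemma vertexSet_part {G : Graph α β} {W : Set α} {D : Set β} : V(G.part W D) = V(G) ∩ W := rfl

lemma edgeSet_part_subset {G : Graph α β} {W : Set α} {D : Set β} : E(G.part W D) ⊆ D := by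
  intro e he
  obtain ⟨u, v, h⟩ := exists_isLink_of_mem_edgeSet he
  exact (part_isLink.1 h).1

lemma part_le {G : Graph α β} {W : Set α} {D : Set β} : G.part W D ≤ G :=
  ⟨Set.inter_subset_left, fun _ _ _ h ↦ (part_isLink.1 h).2.1⟩

lemma reflTransGen_adj_symm {G : Graph α β} {u v : α} (h : Relation.ReflTransGen G.Adj u v) :
    Relation.ReflTransGen G.Adj v u := by
  induction h with
  | refl => exact .refl
  | tail _ h ih => exact ih.head h.symm

/-- A graph is connected if all its vertices are joined to one of them. -/
lemma isConnected_of_forall {G : Graph α β} {c : α} (hc : c ∈ V(G))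
    (h : ∀ v ∈ V(G), Relation.ReflTransGen G.Adj v c) : G.IsConnected :=
  ⟨⟨c, hc⟩, fun u hu v hv ↦ ⟨hu, (h u hu).trans (reflTransGen_adj_symm (h v hv))⟩⟩

lemma SimplePath.length_pos {G : Graph α β} {x y : α} (p : G.SimplePath x y) (hxy : x ≠ y) :
    0 < p.length := by
  by_contra h
  refine hxy (p.vert_zero.symm.trans (Eq.trans ?_ p.vert_length))
  rw [Nat.eq_zero_of_not_pos h]

lemma SimplePath.reflTransGen {G : Graph α β} {x y : α} (p : G.SimplePath x y) {R : α → α → Prop}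
    {a : ℕ} (ha : a ≤ p.length)
    (hR : ∀ j, a ≤ j → j < p.length → R (p.vert j) (p.vert (j + 1))) :
    Relation.ReflTransGen R (p.vert a) y := by
  obtain ⟨d, hd⟩ : ∃ d, p.length = a + d := ⟨p.length - a, by omega⟩
  have : ∀ d, a + d ≤ p.length → Relation.ReflTransGen R (p.vert a) (p.vert (a + d)) := by
    intro d
    induction d with
    | zero => exact fun _ ↦ .refl
    | succ d ih => exact fun h ↦ (ih (by omega)).tail (hR (a + d) (by omega) (by omega))
  have h := this d hd.ge
  rwa [← hd, p.vert_length] at h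

/-- A path from `u` to `s` and an edge outside of it that joins `s` to `u` form a cycle. -/
lemma SimplePath.exists_cycle {G : Graph α β} {u s : α} (r : G.SimplePath u s) {e : β}
    (he : G.IsLink e s u) (her : e ∉ r.edges) (hus : u ≠ s) :
    ∃ C : Graph α β, C ≤ G ∧ C.IsCycle ∧ s ∈ V(C) := by
  classical
  have hlen : 0 < r.length := r.length_pos hus
  have hvG : ∀ i ≤ r.length, r.vert i ∈ V(G) := by
    intro i hi
    rcases hi.lt_or_eq with h | h
    · exact (r.isLink i h).left_mem
    · rw [h, r.vert_length]; exact he.left_mem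
  set C := G.part r.verts (insert e r.edges) with hC
  have hV : V(C) = r.verts := by
    rw [hC, vertexSet_part, Set.inter_eq_right]
    rintro _ ⟨i, hi, rfl⟩
    exact hvG i hi
  have hu : u ∈ r.verts := ⟨0, Nat.zero_le _, r.vert_zero⟩
  have hs : s ∈ r.verts := ⟨_, le_rfl, r.vert_length⟩
  have hlink : ∀ j < r.length, C.IsLink (r.edge j) (r.vert j) (r.vert (j + 1)) := fun j hj ↦
    part_isLink.2 ⟨.inr ⟨j, hj, rfl⟩, r.isLink j hj, ⟨j, hj.le, rfl⟩, ⟨j + 1, hj, rfl⟩⟩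
  have hlinke : C.IsLink e s u := part_isLink.2 ⟨.inl rfl, he, hs, hu⟩
  refine ⟨C, part_le, ⟨?_, ?_, ?_, ?_⟩, by rwa [hV]⟩
  · rw [hV]
    exact ((Set.finite_Iic r.length).image r.vert).subset fun v ⟨j, hj, h⟩ ↦ ⟨j, hj, h⟩
  · refine (Set.Finite.insert e ?_).subset edgeSet_part_subset
    exact ((Set.finite_Iio r.length).image r.edge).subset fun f ⟨j, hj, h⟩ ↦ ⟨j, hj, h⟩
  · refine isConnected_of_forall (c := s) (by rwa [hV]) ?_
    rw [hV]
    rintro _ ⟨j, hj, rfl⟩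
    exact r.reflTransGen hj fun j _ hj ↦ (hlink j hj).adj
  · rw [hV]
    rintro _ ⟨i, hi, rfl⟩
    -- the two edges of the cycle at vertex `i` of the path
    let pred : β := if i = 0 then e else r.edge (i - 1)
    let succ : β := if i = r.length then e else r.edge i
    have hinc : C.incidenceSet (r.vert i) = {pred, succ} := by
      ext f
      simp only [mem_incidenceSet, Set.mem_insert_iff, Set.mem_singleton_iff]
      constructor
      · intro hf
        rcases edgeSet_part_subset hf.edge_mem with rfl | ⟨j, hj, rfl⟩
        · rcases hf.eq_or_eq_of_isLink hlinke with h | h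
          · exact .inr (if_pos (r.vert_inj i hi _ le_rfl (h.trans r.vert_length.symm))).symm
          · exact .inl (if_pos (r.vert_inj i hi _ (Nat.zero_le _) (h.trans r.vert_zero.symm))).symm
        · rcases hf.eq_or_eq_of_isLink (hlink j hj) with h | h
          · obtain rfl := r.vert_inj i hi j hj.le h
            exact .inr (if_neg hj.ne).symm
          · obtain rfl := r.vert_inj i hi (j + 1) hj h
            exact .inl (if_neg j.succ_ne_zero).symm
      · rintro (rfl | rfl)
        · by_cases h : i = 0
          · simp only [pred, if_pos h]
            rw [h, r.vert_zero]
            exact hlinke.inc_right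
          · simp only [pred, if_neg h]
            have := (hlink (i - 1) (by omega)).inc_right
            rwa [Nat.sub_add_cancel (by omega)] at this
        · by_cases h : i = r.length
          · simp only [succ, if_pos h]
            rw [h, r.vert_length]
            exact hlinke.inc_left
          · simp only [succ, if_neg h]
            exact (hlink i (by omega)).inc_left
    have hne : pred ≠ succ := by
      have hmem : ∀ j < r.length, r.edge j ≠ e := fun j hj h ↦ her ⟨j, hj, h⟩
      by_cases h0 : i = 0 <;> by_cases h1 : i = r.length
      · omega
      · simp only [pred, succ, if_pos h0, if_neg h1]
        exact (hmem i (by omega)).symm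
      · simp only [pred, succ, if_neg h0, if_pos h1]
        exact hmem _ (by omega)
      · simp only [pred, succ, if_neg h0, if_neg h1]
        intro h
        have := r.edge_inj (by omega) (by omega) h
        omega
    have hloop : C.loopSet (r.vert i) = ∅ := by
      rw [Set.eq_empty_iff_forall_notMem]
      intro f hf
      have hf : C.IsLink f (r.vert i) (r.vert i) := hf
      rcases edgeSet_part_subset hf.edge_mem with rfl | ⟨j, hj, rfl⟩
      · rcases hf.eq_and_eq_or_eq_and_eq hlinke with ⟨h, h'⟩ | ⟨h, h'⟩
        · exact hus (h'.symm.trans h)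
        · exact hus (h.symm.trans h')
      · rcases hf.eq_and_eq_or_eq_and_eq (hlink j hj) with ⟨h, h'⟩ | ⟨h, h'⟩ <;>
        · have := r.vert_inj _ (by omega) _ (by omega) h
          have := r.vert_inj _ (by omega) _ (by omega) h'
          omega
    rw [degree, hinc, hloop, Set.ncard_pair hne, Set.ncard_empty]

/-- Two edge-disjoint paths from `s` to `c ≠ s` contain a cycle through `s`. -/
lemma SimplePath.exists_cycle_of_disjoint {G : Graph α β} {s c : α} (hsc : s ≠ c)
    (p q : G.SimplePath s c) (hpq : Disjoint p.edges q.edges) :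
    ∃ C : Graph α β, C ≤ G ∧ C.IsCycle ∧ s ∈ V(C) := by
  have hlen : 0 < p.length := p.length_pos hsc
  have he := p.isLink 0 hlen
  rw [p.vert_zero] at he
  have : Nonempty β := ⟨p.edge 0⟩
  let R : α → α → Prop := fun u v ↦ ∃ f ∈ ({p.edge 0}ᶜ : Set β), G.IsLink f u v ∧ v ∉ (∅ : Set α)
  -- go along `p` from its second vertex to `c`, and back to `s` along `q`
  have h1 : Relation.ReflTransGen R (p.vert 1) c := p.reflTransGen (a := 1) hlen fun j h1 h2 ↦
    ⟨p.edge j, fun h ↦ absurd (p.edge_inj h2 hlen h) (by omega), p.isLink j h2, by simp⟩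
  have h2 : Relation.ReflTransGen R s c := by
    rw [← q.vert_zero]
    exact q.reflTransGen (Nat.zero_le _) fun j _ hj ↦ ⟨q.edge j,
      fun h ↦ Set.disjoint_left.1 hpq ⟨0, hlen, rfl⟩ ⟨j, hj, h⟩, q.isLink j hj, by simp⟩
  have h3 : ∀ v, Relation.ReflTransGen R s v → Relation.ReflTransGen R v s := by
    intro v hv
    induction hv with
    | refl => exact .refl
    | tail _ h ih =>
      obtain ⟨f, hf, hl, -⟩ := h
      exact ih.head ⟨f, hf, hl.symm, by simp⟩
  obtain ⟨r, hr, -⟩ := SimplePath.exists_of_reflTransGen (h1.trans (h3 c h2))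
  refine r.exists_cycle he (fun h ↦ hr h rfl) fun h ↦ ?_
  exact absurd (p.vert_inj 1 hlen 0 (Nat.zero_le _) (h.trans p.vert_zero.symm)) (by omega)

/-! ### Immersions from spiders -/

/-- A path in `G` as a path in a subgraph that has its edges. -/
def SimplePath.transfer {G H : Graph α β} {x y : α} (p : G.SimplePath x y)
    (h : ∀ j < p.length, H.IsLink (p.edge j) (p.vert j) (p.vert (j + 1))) : H.SimplePath x y :=
  ⟨p.length, p.vert, p.edge, p.vert_zero, p.vert_length, h, p.vert_inj⟩

/-- If `k` edge-disjoint paths run to `c` from each vertex of `S`, with no vertex of `S` inside of a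
path, then every graph of maximum degree at most `k` with at most `|S|` vertices is strongly
immersed. The vertices are mapped into `S`, a path at `s` is reserved for each end of an edge at the
vertex that is mapped to `s`, and an edge is mapped to the union of the two paths reserved for its
ends. -/
theorem stronglyImmersed_of_spider {G : Graph α β} {F : Graph γ δ} (hFV : V(F).Finite)
    (hFE : E(F).Finite) {c : α} (hc : c ∈ V(G)) {S : Finset α} (hSV : ↑S ⊆ V(G) \ {c}) {k : ℕ}
    (hdeg : ∀ v ∈ V(F), F.degree v ≤ k) (hcard : V(F).ncard ≤ S.card)
    (q : ∀ i : S × Fin k, G.SimplePath (i.1 : α) c)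
    (hq : ∀ i j, i ≠ j → Disjoint (q i).edges (q j).edges)
    (hqS : ∀ i, ∀ j, 0 < j → j ≤ (q i).length → (q i).vert j ∉ S) : F.StronglyImmersed G := by
  classical
  have := hFV.fintype
  obtain ⟨φ⟩ : Nonempty (V(F) ↪ S) := Function.Embedding.nonempty_of_card_le (by
    rwa [Fintype.card_coe, ← Nat.card_eq_fintype_card, Nat.card_coe_set_eq])
  have hport : ∀ v : V(F), Nonempty (F.incidenceSet v ⊕ F.loopSet v ↪ Fin k) := by
    intro v
    have := (hFE.subset (F.incidenceSet_subset_edgeSet v)).fintype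
    have := (hFE.subset ((F.loopSet_subset_incidenceSet v).trans
      (F.incidenceSet_subset_edgeSet v))).fintype
    refine Function.Embedding.nonempty_of_card_le ?_
    rw [Fintype.card_sum, Fintype.card_fin, ← Nat.card_eq_fintype_card, ← Nat.card_eq_fintype_card,
      Nat.card_coe_set_eq, Nat.card_coe_set_eq]
    exact hdeg v v.2
  have port : ∀ v : V(F), F.incidenceSet v ⊕ F.loopSet v ↪ Fin k := fun v ↦ (hport v).some
  -- the path reserved for the first or second end of `e` at `v`
  let edgeOf : ∀ v : V(F), F.incidenceSet v ⊕ F.loopSet v → δ := fun v ↦ Sum.elim (·.1) (·.1)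
  let J : δ → Set (S × Fin k) := fun e ↦ {i | ∃ v, ∃ t, edgeOf v t = e ∧ i = (φ v, port v t)}
  have hJinc : ∀ (v : V(F)) t, F.Inc (edgeOf v t) v := by
    rintro v (t | t)
    · exact t.2
    · exact IsLoopAt.inc t.2
  have hJdisj : ∀ e f i, i ∈ J e → i ∈ J f → e = f := by
    rintro e f i ⟨v, t, rfl, rfl⟩ ⟨v', t', rfl, h⟩
    obtain ⟨h1, h2⟩ := Prod.mk.inj h
    obtain rfl := φ.injective h1
    rw [(port v).injective h2]
  let W : δ → Set α := fun e ↦ {x | ∃ i ∈ J e, x ∈ (q i).verts}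
  let D : δ → Set β := fun e ↦ {f | ∃ i ∈ J e, f ∈ (q i).edges}
  have hlink : ∀ e, ∀ i ∈ J e, ∀ j < (q i).length,
      (G.part (W e) (D e)).IsLink ((q i).edge j) ((q i).vert j) ((q i).vert (j + 1)) :=
    fun e i hi j hj ↦ part_isLink.2 ⟨⟨i, hi, j, hj, rfl⟩, (q i).isLink j hj,
      ⟨i, hi, j, hj.le, rfl⟩, ⟨i, hi, j + 1, hj, rfl⟩⟩
  have hstart : ∀ (e : δ) (v : V(F)), F.Inc e v → ((φ v : S) : α) ∈ V(G.part (W e) (D e)) := by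
    intro e v h
    refine ⟨(hSV (φ v).2).1, (φ v, port v (.inl ⟨e, h⟩)), ⟨v, _, rfl, rfl⟩, 0, Nat.zero_le _, ?_⟩
    exact (q _).vert_zero
  refine ⟨⟨fun v ↦ ⟨φ v, (hSV (φ v).2).1⟩, fun e ↦ G.part (W e) (D e), ?_, fun e ↦ part_le, ?_, ?_,
    fun e v h ↦ hstart e v h, ?_⟩, ?_⟩
  · intro v v' h
    exact φ.injective (Subtype.ext (congrArg (fun x : V(G) ↦ (x : α)) h))
  · intro e
    obtain ⟨x, y, hxy⟩ := exists_isLink_of_mem_edgeSet e.2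
    let v : V(F) := ⟨x, hxy.left_mem⟩
    refine isConnected_of_forall (c := c) ⟨hc, _, ⟨v, .inl ⟨e, hxy.inc_left⟩, rfl, rfl⟩, _, le_rfl,
      (q _).vert_length⟩ ?_
    rintro _ ⟨-, i, hi, j, hj, rfl⟩
    exact (q i).reflTransGen hj fun l _ hl ↦ (hlink e i hi l hl).adj
  · intro e f hef
    refine Set.disjoint_of_subset edgeSet_part_subset edgeSet_part_subset ?_
    rw [Set.disjoint_left]
    rintro d ⟨i, hi, hdi⟩ ⟨j, hj, hdj⟩
    have hij : i = j := by
      by_contra hne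
      exact Set.disjoint_left.1 (hq i j hne) hdi hdj
    subst hij
    exact hef (Subtype.ext (hJdisj _ _ i hi hj))
  · intro e v hloop
    -- two different paths are reserved for the two ends of a loop
    let t₁ : F.incidenceSet v ⊕ F.loopSet v := .inl ⟨e, hloop.inc⟩
    let t₂ : F.incidenceSet v ⊕ F.loopSet v := .inr ⟨e, hloop⟩
    have hne : (φ v, port v t₁) ≠ (φ v, port v t₂) := fun h ↦ by
      have := (port v).injective (Prod.mk.inj h).2
      simp [t₁, t₂] at this
    have hsc : ((φ v : S) : α) ≠ c := fun h ↦ (hSV (φ v).2).2 h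
    exact SimplePath.exists_cycle_of_disjoint hsc
      ((q (φ v, port v t₁)).transfer (hlink e _ ⟨v, t₁, rfl, rfl⟩))
      ((q (φ v, port v t₂)).transfer (hlink e _ ⟨v, t₂, rfl, rfl⟩)) (hq _ _ hne)
  · rintro e v hinc ⟨-, i, ⟨v', t, ht, rfl⟩, j, hj, hv⟩
    rcases Nat.eq_zero_or_pos j with rfl | h0
    · have h1 := (q (φ v', port v' t)).vert_zero.symm.trans hv
      obtain rfl := φ.injective (Subtype.ext h1)
      exact hinc (ht ▸ hJinc v' t)
    · exact hqS _ j h0 hj (hv ▸ (φ v).2)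

end Graph

theorem theorem5 {α β γ δ : Type*} (G : Graph α β) (F : Graph γ δ)
    (hGV : V(G).Finite) (hGE : E(G).Finite) (hFV : V(F).Finite) (hFE : E(F).Finite)
    (k : ℕ) (hk : 3 ≤ k)
    (c : α) (hc : c ∈ V(G)) (X : Set α) (hX : X ⊆ V(G) \ {c})
    (hcut : ∀ x ∈ X, ¬ ∃ K : Set β, G.IsEdgeCutBetween K c x ∧ K.ncard < k)
    (hdeg : ∀ v ∈ V(F), F.degree v ≤ k)
    (hF : ¬ F.StronglyImmersed G) :
    ∃ (Y : Set α) (K : Set β), Y ⊆ X ∧ K ⊆ E(G) ∧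
      k * Y.ncard + K.ncard < Graph.starBound k * V(F).ncard ∧
      Disjoint (((G.deleteVerts Y).deleteEdges K).componentSet c) X := by
  classical
  obtain ⟨X₁, hX₁X, hX₁cut, Y, K, hY, hK, hYK, hsep⟩ :=
    Graph.exists_sources_and_separator hGV hGE hX
  refine ⟨Y, K, hY, hK, ?_, hsep⟩
  by_contra! hlarge
  refine hF ?_
  have hk0 : 0 < k := by omega
  have hconn : ∀ B ⊆ V(G) \ {c}, (∃ x ∈ X₁, x ∈ B) → k ≤ (G.edgeBoundary B ∅).ncard := by
    rintro B hB ⟨x, hx, hxB⟩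
    by_contra! hlt
    refine hcut x (hX₁X hx) ⟨_, ⟨G.edgeBoundary_subset B ∅, fun hr ↦ ?_⟩, hlt⟩
    have : ∀ v, Relation.ReflTransGen (G.deleteEdges (G.edgeBoundary B ∅)).Adj c v → v ∉ B := by
      intro v hv
      induction hv with
      | refl => exact fun h ↦ (hB h).2 rfl
      | @tail u w _ huw ih =>
        obtain ⟨e, he⟩ := huw
        simp only [Graph.deleteEdges_isLink] at he
        exact fun hw ↦ he.2 ⟨w, u, he.1.symm, hw, ih, by simp⟩
    exact this x hr.2 hxB
  obtain ⟨X', hX'X₁, hfan, hX'card⟩ := Graph.exists_fan_sources hGV hGE hk0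
    (fun B hB ↦ (hX₁cut B hB).trans (Set.ncard_le_ncard
      (fun e ⟨u, v, h, hu, hv, _⟩ ↦ ⟨u, v, h, hu, hv, by simp⟩)
      (Graph.finite_edgeBoundary hGE _ _))) hconn
  have hX'X : ↑X' ⊆ X := (Finset.coe_subset.2 hX'X₁).trans hX₁X
  have hstar : G.CutCondition c X' 1 ↑X' := fun B hB ↦ (hX₁cut.mono hX'X₁ B hB).trans
    (Set.ncard_le_ncard (fun e ⟨u, v, h, hu, hv, hvX⟩ ↦ ⟨u, v, h, hu, hv, fun h ↦ hvX (hX'X h)⟩)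
      (Graph.finite_edgeBoundary hGE _ _))
  have hcount : (4 * k + 2) * V(F).ncard ≤ X'.card := by
    set n := V(F).ncard
    -- `starBound k * n ≤ k * |X₁| ≤ k * k ^ k * |X'|`, and `starBound k ≥ k * k ^ k * (4k + 2)`
    have h1 : Graph.starBound k * n ≤ k * (k ^ k * X'.card) := by
      calc Graph.starBound k * n ≤ k * Y.ncard + K.ncard := hlarge
        _ ≤ k * (Y.ncard + K.ncard) := by nlinarith [Nat.zero_le K.ncard]
        _ ≤ k * (k ^ k * X'.card) := Nat.mul_le_mul_left _ (hYK.trans hX'card)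
    have h2 : k ^ k * k * (4 * k + 2) ≤ Graph.starBound k := by
      have h3 : k ^ k ≤ (2 * k + 1) ^ (8 * k + 3) :=
        (Nat.pow_le_pow_left (by omega) k).trans (Nat.pow_le_pow_right (by omega) (by omega))
      have h4 : k * (4 * k + 2) ≤ (2 * k + 1) * (k ^ 2 * (k + 1)) := by nlinarith [sq_nonneg k]
      calc k ^ k * k * (4 * k + 2) = k ^ k * (k * (4 * k + 2)) := by ring
        _ ≤ (2 * k + 1) ^ (8 * k + 3) * ((2 * k + 1) * (k ^ 2 * (k + 1))) := Nat.mul_le_mul h3 h4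
        _ = Graph.starBound k := by rw [Graph.starBound]; ring
    have hpos : 0 < k ^ k * k := by positivity
    refine Nat.le_of_mul_le_mul_left ?_ hpos
    calc k ^ k * k * ((4 * k + 2) * n) = k ^ k * k * (4 * k + 2) * n := by ring
      _ ≤ Graph.starBound k * n := Nat.mul_le_mul_right _ h2
      _ ≤ k * (k ^ k * X'.card) := h1
      _ = k ^ k * k * X'.card := by ring
  obtain ⟨S, hSX', hSn, hScut⟩ := Graph.exists_spider_sources hGE (hX'X.trans hX) hfan hstar hcount
  have hSV : ↑S ⊆ V(G) \ {c} := (Finset.coe_subset.2 hSX').trans (hX'X.trans hX)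
  obtain ⟨q, hq, hqS⟩ := hScut.exists_linkage hGE hSV (fun h ↦ (hSV h).2 rfl)
  exact Graph.stronglyImmersed_of_spider hFV hFE hc hSV hdeg hSn q hq hqS
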